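/- **Setting.** A compact 3-manifold triangulation $\mathcal T$ consists of $n$ tetrahedra, some or all of whose $4n$ faces are affinely identified in pairs (vertices, edges or faces of one tetrahedron may be identified with each other), such that the resulting quotient space is a compact 3-manifold, possibly with boundary. Faces that are not identified with another face are boundary faces. A vector in $\mathbb R^{7n}$ has, for each tetrahedron $\Delta_i$, four triangular coordinates $t_{i,1},\dots,t_{i,4}$ (one for each vertex of $\Delta_i$) and three quadrilateral coordinates $q_{i,1},q_{i,2},q_{i,3}$ (one for each way of separating two opposite edges of $\Delta_i$). A vector in $\mathbb R^{3n}$ has only the quadrilateral coordinates. The map $\pi:\mathbb R^{7n}\to\mathbb R^{3n}$ drops the triangular coordinates. *Standard matching equations* (on $\mathbb R^{7n}$): for each non-boundary face $F$, joining $\Delta_i$ and $\Delta_j$, and each edge $e$ of $F$, the equation $t_{i,a}+q_{i,b}=t_{j,c}+q_{j,d}$, where $t_{i,a},q_{i,b}$ (respectively $t_{j,c},q_{j,d}$) belong to the unique triangle and quadrilateral type of $\Delta_i$ (respectively $\Delta_j$) that meet $F$ in an arc parallel to $e$. *Quadrilateral matching equations* (on $\mathbb R^{3n}$): for each non-boundary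 edge $e$, choose an upper and a lower end of $e$ and a direction around $e$; then the sum, over the cycle of tetrahedra around $e$, of the coordinates of the quadrilateral types that rise from the lower end to the upper end equals the sum of the coordinates of those that fall from the upper end to the lower end. *Quadrilateral constraints*: for each $i$, at most one of $q_{i,1},q_{i,2},q_{i,3}$ is non-zero. The standard (respectively quadrilateral) solution set of $\mathcal T$ is the set of those vertices of the polytope of all vectors in $\mathbb R^{7n}$ (respectively $\mathbb R^{3n}$) with non-negative coordinates that sum to $1$ and satisfy the standard (respectively quadrilateral) matching equations, which satisfy the quadrilateral constraints. A vector $\mathbf x$ *dominates* $\mathbf y$ if $y_c=0$ whenever $x_c=0$. The *projective image* of $\mathbf x\neq\mathbf 0$ is $\overline{\mathbf x}=\mathbf x/\sum_c x_c$. **Result.** Let $\mathcal T$ be a compact 3-manifold triangulation built from $n$ tetrahedra, and let its standard solution set consist of the $k$ (distinct) vectors $\mathbf v_1,\dots,\mathbf v_k\in\mathbb R^{7n}$. Consider the following algorithm. 1. Compute $\pi(\mathbf v_1),\dots,\pi(\mathbf v_k)$, throw away the zero vectors, and label the remaining vectors (in order, repetitions kept) $\mathbf q_1,\dots,\mathbf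 q_{k'}\in\mathbb R^{3n}$. 2. Begin with an empty list $L$. For each $i=1,\dots,k'$, test whether $\mathbf q_i$ dominates some $\mathbf q_j$ with $j\ne i$; if not, append $\overline{\mathbf q_i}$ to $L$. 3. Return $L$. Then $L$ has no repeated entries, and its entries are precisely the elements of the quadrilateral solution set of $\mathcal T$. Moreover, the algorithm runs in $O(nk^2)$ time: it is carried out by a fixed program for a random access machine in which copying, adding or dividing a real number, testing whether a real number is zero, and incrementing, adding, copying or comparing counters and addresses each take one step; and there is an absolute constant $C$ such that, for all $n\ge1$, all $\mathcal T$ and all $\mathbf v_1,\dots,\mathbf v_k$ as above, this program makes at most $C\,n\,k^2$ steps. -/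

import Mathlib

noncomputable section

namespace NormalSurface

/-! ## Triangulations -/

/-- `n` tetrahedra, numbered by `Fin n`, each with vertices `Fin 4`, and an affine identification
of some or all of their faces in pairs.  The face `(i, f)` is the face of tetrahedron `i` opposite
its vertex `f`.  `glue i f = none` means that this face is a boundary face.
`glue i f = some (j, p)` means that it is identified with the face `(j, p f)`, by the affine map
that takes each vertex `a ≠ f` of tetrahedron `i` to the vertex `p a` of tetrahedron `j`. -/
structure Gluing (n : ℕ) where
  glue : Fin n → Fin 4 → Option (Fin n × Equiv.Perm (Fin 4))
  symm : ∀ i f j p, glue i f = some (j, p) → glue j (p f) = some (i, p⁻¹)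
  ne_self : ∀ i f j p, glue i f = some (j, p) → (j, p f) ≠ (i, f)

/-- A point of a face (barycentric coordinates `x`, with `x f = 0`) and its image under the
identification of that face. -/
def Gluing.Ident {n : ℕ} (T : Gluing n) (P Q : Fin n × stdSimplex ℝ (Fin 4)) : Prop :=
  ∃ f p, T.glue P.1 f = some (Q.1, p) ∧ P.2.1 f = 0 ∧ ∀ a, Q.2.1 (p a) = P.2.1 a

/-- The topological space obtained from the `n` tetrahedra (quotient topology, for the equivalence
relation generated by the identifications of the faces). -/
abbrev Gluing.Space {n : ℕ} (T : Gluing n) : Type :=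
  Quot T.Ident

/-- A compact topological 3-manifold, possibly with boundary, not necessarily connected. -/
def IsCompactThreeManifold (X : Type) [TopologicalSpace X] : Prop :=
  CompactSpace X ∧ T2Space X ∧ SecondCountableTopology X ∧
    Nonempty (ChartedSpace (EuclideanHalfSpace 3) X)

/-- A compact 3-manifold triangulation built from `n` tetrahedra. -/
structure Triangulation (n : ℕ) extends Gluing n where
  manifold : IsCompactThreeManifold toGluing.Space

/-! ## Coordinates and matching equations -/

/-- The `7 n` disc types: `(i, Sum.inl a)` is the triangle in tetrahedron `i` that surrounds the
vertex `a`, and `(i, Sum.inr k)` is the quadrilateral of type `k` in tetrahedron `i`, which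
separates the edge `{0, k + 1}` from the opposite edge. -/
abbrev StdCoord (n : ℕ) : Type := Fin n × (Fin 4 ⊕ Fin 3)

/-- The `3 n` quadrilateral disc types. -/
abbrev QuadCoord (n : ℕ) : Type := Fin n × Fin 3

/-- The space `ℝ^{7n}`. -/
abbrev StdVec (n : ℕ) : Type := StdCoord n → ℝ

/-- The space `ℝ^{3n}`. -/
abbrev QuadVec (n : ℕ) : Type := QuadCoord n → ℝ

/-- For distinct vertices `a`, `b` of a tetrahedron, the type of the quadrilateral that separates
the edge `{a, b}` from the opposite edge (the diagonal values are never used). -/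
def quadSep (a b : Fin 4) : Fin 3 :=
  ![![0, 0, 1, 2],
    ![0, 0, 2, 1],
    ![1, 2, 0, 0],
    ![2, 1, 0, 0]] a b

/-- The standard matching equations.  For each non-boundary face, seen from tetrahedron `i` as the
face opposite `f`, and each edge of that face, given by the third vertex `a` of the face: the arcs
of the face parallel to that edge (that is, the arcs that cut off `a`) come from the triangles
around `a` and from the quadrilaterals that separate `{a, f}` from the other two vertices. -/
def StdMatching {n : ℕ} (T : Gluing n) (v : StdVec n) : Prop :=
  ∀ i f j p, T.glue i f = some (j, p) → ∀ a, a ≠ f →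
    v (i, Sum.inl a) + v (i, Sum.inr (quadSep a f)) =
      v (j, Sum.inl (p a)) + v (j, Sum.inr (quadSep (p a) (p f)))

/-- A tetrahedron seen from one of its edges, when we move around that edge: `(i, s)` is
tetrahedron `i`, the lower end `s 0` and the upper end `s 1` of the edge, the face opposite `s 2`
through which we come in, and the face opposite `s 3` through which we go out. -/
abbrev EdgeFlag (n : ℕ) : Type := Fin n × Equiv.Perm (Fin 4)

/-- Going out through the face opposite `s 3` into the next tetrahedron around the edge, if that
face is not a boundary face. -/
def Gluing.next {n : ℕ} (T : Gluing n) (x : EdgeFlag n) : Option (EdgeFlag n) :=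
  (T.glue x.1 (x.2 3)).map fun y => (y.1, y.2 * x.2 * Equiv.swap 2 3)

/-- `x 0, …, x (m - 1)` is the cycle of tetrahedra around a non-boundary edge. -/
def Gluing.IsEdgeCycle {n : ℕ} (T : Gluing n) (m : ℕ) (x : ℕ → EdgeFlag n) : Prop :=
  0 < m ∧ (∀ r < m, T.next (x r) = some (x (r + 1))) ∧ x m = x 0 ∧ Set.InjOn x (Set.Iio m)

/-- The upward quadrilateral at an edge: in the face opposite `s 2`, where we come in, it cuts off
the lower end `s 0`, and in the face opposite `s 3`, where we go out, the upper end `s 1`. -/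
def upward {n : ℕ} (x : EdgeFlag n) : QuadCoord n := (x.1, quadSep (x.2 0) (x.2 2))

/-- The downward quadrilateral at an edge: it cuts off the upper end in the face opposite `s 2`,
where we come in, and the lower end in the face opposite `s 3`, where we go out. -/
def downward {n : ℕ} (x : EdgeFlag n) : QuadCoord n := (x.1, quadSep (x.2 0) (x.2 3))

/-- The quadrilateral matching equations, one for each non-boundary edge (every choice of the
direction around the edge, of its upper end and of the first tetrahedron is listed, and all these
choices give the same equation). -/
def QuadMatching {n : ℕ} (T : Gluing n) (q : QuadVec n) : Prop :=
  ∀ m x, T.IsEdgeCycle m x →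
    ∑ r ∈ Finset.range m, q (upward (x r)) = ∑ r ∈ Finset.range m, q (downward (x r))

/-! ## Solution sets -/

/-- The quadrilateral projection `ℝ^{7n} → ℝ^{3n}`. -/
def quadProj {n : ℕ} (v : StdVec n) : QuadVec n := fun c => v (c.1, Sum.inr c.2)

/-- The quadrilateral constraints: in each tetrahedron at most one quadrilateral coordinate is
non-zero. -/
def QuadConstraints {n : ℕ} (q : QuadVec n) : Prop :=
  ∀ i k l, k ≠ l → q (i, k) = 0 ∨ q (i, l) = 0

/-- The standard projective solution space. -/
def stdSolutionSpace {n : ℕ} (T : Gluing n) : Set (StdVec n) :=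
  {v | (∀ c, 0 ≤ v c) ∧ ∑ c, v c = 1 ∧ StdMatching T v}

/-- The quadrilateral projective solution space. -/
def quadSolutionSpace {n : ℕ} (T : Gluing n) : Set (QuadVec n) :=
  {q | (∀ c, 0 ≤ q c) ∧ ∑ c, q c = 1 ∧ QuadMatching T q}

/-- The standard solution set: the vertices of the standard projective solution space that satisfy
the quadrilateral constraints. -/
def stdSolutionSet {n : ℕ} (T : Gluing n) : Set (StdVec n) :=
  {v | v ∈ (stdSolutionSpace T).extremePoints ℝ ∧ QuadConstraints (quadProj v)}

/-- The quadrilateral solution set: the vertices of the quadrilateral projective solution space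
that satisfy the quadrilateral constraints. -/
def quadSolutionSet {n : ℕ} (T : Gluing n) : Set (QuadVec n) :=
  {q | q ∈ (quadSolutionSpace T).extremePoints ℝ ∧ QuadConstraints q}

/-! ## The conversion, as a function of the list of vectors -/

/-- The projective image `x / ∑ x_i` (the zero vector for `x = 0`). -/
def projImage {ι : Type} [Fintype ι] (x : ι → ℝ) : ι → ℝ := fun c => x c / ∑ d, x d

/-- `x` dominates `y`: wherever `x` is zero, so is `y`. -/
def Dominates {ι : Type} (x y : ι → ℝ) : Prop := ∀ c, x c = 0 → y c = 0

open Classical in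
/-- First step: the list `q_1, …, q_{k'}` of the non-zero quadrilateral projections. -/
def projections {n k : ℕ} (v : Fin k → StdVec n) : List (QuadVec n) :=
  ((List.ofFn v).map quadProj).filter fun q => q ≠ 0

open Classical in
/-- Second step: the list of the projective images of those `q_i` that dominate no `q_j` with
`j ≠ i`. -/
def selection {n : ℕ} (q : List (QuadVec n)) : List (QuadVec n) :=
  ((List.finRange q.length).filter fun i => ∀ j, j ≠ i → ¬ Dominates (q.get i) (q.get j)).map
    fun i => projImage (q.get i)

/-- The list that the conversion algorithm returns. -/
def stdToQuad {n k : ℕ} (v : Fin k → StdVec n) : List (QuadVec n) := selection (projections v)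

/-! ## A real random access machine with a step count -/

/-- Programs, for a machine with registers `N` for natural numbers (counters and addresses),
registers `R` for real numbers, and arrays `A` of real numbers. -/
inductive Cmd (N R A : Type) : Type
  /-- do nothing -/
  | skip : Cmd N R A
  /-- `x := c` -/
  | const (x : N) (c : ℕ) : Cmd N R A
  /-- `x := y` -/
  | copy (x y : N) : Cmd N R A
  /-- `x := y + z` -/
  | plus (x y z : N) : Cmd N R A
  /-- `x := x + 1` -/
  | incr (x : N) : Cmd N R A
  /-- `u := 0` -/
  | rzero (u : R) : Cmd N R A
  /-- `u := v + w` -/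
  | rplus (u v w : R) : Cmd N R A
  /-- `u := v / w` -/
  | rdiv (u v w : R) : Cmd N R A
  /-- `u := a[x]` -/
  | load (u : R) (a : A) (x : N) : Cmd N R A
  /-- `a[x] := u` -/
  | store (a : A) (x : N) (u : R) : Cmd N R A
  /-- first `c`, then `d` -/
  | seq (c d : Cmd N R A) : Cmd N R A
  /-- `c` if `x = y`, and `d` otherwise -/
  | ifEq (x y : N) (c d : Cmd N R A) : Cmd N R A
  /-- `c` if `u = 0`, and `d` otherwise -/
  | ifZero (u : R) (c d : Cmd N R A) : Cmd N R A
  /-- repeat `c` as often as the value of `x` at the start of the loop says -/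
  | loop (x : N) (c : Cmd N R A) : Cmd N R A

infixr:60 " ;; " => Cmd.seq

/-- A state of the machine, with the number of steps made so far. -/
structure State (N R A : Type) where
  nat : N → ℕ
  real : R → ℝ
  arr : A → ℕ → ℝ
  time : ℕ

section Machine

variable {N R A : Type} [DecidableEq N] [DecidableEq R] [DecidableEq A]

/-- One step of the clock. -/
def State.tick (s : State N R A) : State N R A := { s with time := s.time + 1 }

/-- Assign the value `m` to the register `x`, in one step. -/
def State.setNat (s : State N R A) (x : N) (m : ℕ) : State N R A :=
  { s.tick with nat := Function.update s.nat x m }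

/-- Assign the value `t` to the register `u`, in one step. -/
def State.setReal (s : State N R A) (u : R) (t : ℝ) : State N R A :=
  { s.tick with real := Function.update s.real u t }

/-- Assign the value `t` to the entry of the array `a` at the address `m`, in one step. -/
def State.setArr (s : State N R A) (a : A) (m : ℕ) (t : ℝ) : State N R A :=
  { s.tick with arr := Function.update s.arr a (Function.update (s.arr a) m t) }

/-- The effect of a program.  Every basic instruction and every test takes one step; a loop takes
one step to start and, in each round, one step besides those of its body. -/
def run : Cmd N R A → State N R A → State N R A
  | .skip, s => s.tick
  | .const x c, s => s.setNat x c
  | .copy x y, s => s.setNat x (s.nat y)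
  | .plus x y z, s => s.setNat x (s.nat y + s.nat z)
  | .incr x, s => s.setNat x (s.nat x + 1)
  | .rzero u, s => s.setReal u 0
  | .rplus u v w, s => s.setReal u (s.real v + s.real w)
  | .rdiv u v w, s => s.setReal u (s.real v / s.real w)
  | .load u a x, s => s.setReal u (s.arr a (s.nat x))
  | .store a x u, s => s.setArr a (s.nat x) (s.real u)
  | .seq c d, s => run d (run c s)
  | .ifEq x y c d, s => if s.nat x = s.nat y then run c s.tick else run d s.tick
  | .ifZero u c d, s => if s.real u = 0 then run c s.tick else run d s.tick
  | .loop x c, s => (fun s' => run c s'.tick)^[s.nat x] s.tick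

end Machine

/-! ## The conversion, as a program -/

/-- The counters and addresses of the program.  `dim` and `size` hold the input `n` and `k`, and
`len` holds the length of the output. -/
inductive NReg : Type
  | dim | size | len
  | one | three | dim3 | flag | src | dst | base | count
  | i | j | baseI | baseJ | atI | atJ | dom | keep | out
  deriving DecidableEq

/-- The real registers of the program. -/
inductive RReg : Type
  | x | y | sum
  deriving DecidableEq

/-- The arrays of the program: the input, the non-zero projections, and the output. -/
inductive Arr : Type
  | input | proj | output
  deriving DecidableEq

namespace Program

open Cmd NReg RReg Arr

/-- First step: copy the quadrilateral coordinates of each input vector, one vector after another,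
to the array `proj`.  A zero vector is overwritten by the vector that follows it. -/
def project : Cmd NReg RReg Arr :=
  const one 1 ;; const three 3 ;; const src 0 ;; const base 0 ;; const count 0 ;;
  loop size (
    const flag 0 ;; copy dst base ;;
    loop dim (
      incr src ;; incr src ;; incr src ;; incr src ;;
      loop three (
        load x input src ;; store proj dst x ;;
        ifZero x skip (const flag 1) ;;
        incr src ;; incr dst)) ;;
    ifEq flag one (incr count ;; copy base dst) skip)

/-- Set `dom` to `1` if the vector at the address `baseI` dominates the one at `baseJ`, and to `0`
if it does not. -/
def testDominates : Cmd NReg RReg Arr :=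
  const dom 1 ;; copy atI baseI ;; copy atJ baseJ ;;
  loop dim3 (
    load x proj atI ;; load y proj atJ ;;
    ifZero x (ifZero y skip (const dom 0)) skip ;;
    incr atI ;; incr atJ)

/-- Append the projective image of the vector at the address `baseI` to the output. -/
def emit : Cmd NReg RReg Arr :=
  rzero sum ;; copy atI baseI ;;
  loop dim3 (load x proj atI ;; rplus sum sum x ;; incr atI) ;;
  copy atI baseI ;;
  loop dim3 (
    load x proj atI ;; rdiv x x sum ;; store output out x ;; incr atI ;; incr out) ;;
  incr len

/-- Second step: compare each projection with all the others, and append the projective images of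
those that dominate no other one to the output. -/
def select : Cmd NReg RReg Arr :=
  plus dim3 dim dim ;; plus dim3 dim3 dim ;;
  const len 0 ;; const out 0 ;; const i 0 ;; const baseI 0 ;;
  loop count (
    const keep 1 ;; const j 0 ;; const baseJ 0 ;;
    loop count (
      ifEq i j skip (testDominates ;; ifEq dom one (const keep 0) skip) ;;
      incr j ;; plus baseJ baseJ dim3) ;;
    ifEq keep one emit skip ;;
    incr i ;; plus baseI baseI dim3)

/-- The whole algorithm. -/
def stdToQuad : Cmd NReg RReg Arr := project ;; select

end Program

/-- The place of a coordinate in a vector of `ℝ^{7n}`, in the order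
`t_{1,1}, …, t_{1,4}, q_{1,1}, …, q_{1,3}; t_{2,1}, …`, counted from zero. -/
def stdPos {n : ℕ} : StdCoord n → ℕ
  | (i, .inl a) => 7 * i.val + a.val
  | (i, .inr k) => 7 * i.val + 4 + k.val

/-- The place of a coordinate in a vector of `ℝ^{3n}`, in the order
`q_{1,1}, q_{1,2}, q_{1,3}; q_{2,1}, …`, counted from zero. -/
def quadPos {n : ℕ} (c : QuadCoord n) : ℕ := 3 * c.1.val + c.2.val

/-- The machine holds `n`, `k` and the vectors `v_1, …, v_k`, one after another in the input array
(the rest of the memory is arbitrary). -/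
def HoldsInput {n k : ℕ} (v : Fin k → StdVec n) (s : State NReg RReg Arr) : Prop :=
  s.nat .dim = n ∧ s.nat .size = k ∧
    ∀ (j : Fin k) (c : StdCoord n), s.arr .input (7 * n * j.val + stdPos c) = v j c

/-- The machine holds the list `L`: its length, and its vectors one after another in the output
array. -/
def HoldsOutput {n : ℕ} (L : List (QuadVec n)) (s : State NReg RReg Arr) : Prop :=
  s.nat .len = L.length ∧
    ∀ (r : Fin L.length) (c : QuadCoord n),
      s.arr .output (3 * n * r.val + quadPos c) = L.get r c

end NormalSurface

end

/-! ### Local primitives of real one-cocycles. -/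

section

open Filter Topology Set

/-! Everything rests on how the projection relates the two solution cones. Around an edge the
triangle coordinates telescope out of the standard equations, so projections of standard solutions
are quadrilateral solutions (`StdMatching.quadMatching`). The converse,
`Triangulation.exists_quadProj_eq`, is the topological core. Given a quadrilateral solution, the
missing triangle coordinates must have prescribed jumps across the faces, so they form a potential
for a one-cocycle on the vertex links. The quadrilateral equations say that the jumps sum to zero
around every interior corner of a link; the remaining obstruction is the first cohomology of the
link.

The links need not be classified. Corner values (`QuadMatching.exists_corner_potential`) are
interpolated to a cocycle on the points of the quotient near, but not at, its vertices. In a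
3-manifold with boundary such a cocycle has a primitive on a small punctured neighbourhood
(`exists_primitiveOn_punctured_nhds`): a ball or half-ball minus a point is a union of two
star-shaped sets with connected overlap. Comparing the primitive with the interpolation on each
corner gives the potential (`IsCornerPotential.exists_potential`), and adding a constant makes it
non-negative.

The rest is convexity. A vertex of a slice of the simplex has minimal support
(`eq_smul_of_mem_extremePoints`), and suitable faces contain vertices
(`exists_mem_extremePoints_simplexSlice`). Hence every quadrilateral vertex satisfying the
constraints is, up to scale, the projection of a standard one, and every non-zero projection from
the standard solution set dominates such a quadrilateral vertex. Moreover a standard vertex with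
non-zero projection is determined by the ray of that projection (`eq_of_smul_quadProj_eq`), since a
surplus of triangles would put a vertex with quadrilaterals above a solution made of triangles only.
So a projection on the ray of a quadrilateral vertex dominates no other entry of the list, and any
other projection does dominate one.

The program is verified by loop invariants that carry a time bound. At most `k ^ 2` comparisons of
cost `O(n)` dominate the count; `stdSolutionSet_nonempty` gives `k > 0`, so that lower-order terms
are absorbed. -/

/-- A germ of a one-cocycle with real coefficients: near every point `x`, the function `w x` is a
local primitive, and the local primitives at nearby points differ by constants. -/
def IsGermCocycle {X : Type*} [TopologicalSpace X] (w : X → X → ℝ) : Prop :=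
  ∀ x, ∀ᶠ y in 𝓝 x, ∀ᶠ z in 𝓝 y, w x z = w x y + w y z

/-- The version of `IsGermCocycle` on a subset. -/
def IsGermCocycleOn {X : Type*} [TopologicalSpace X] (w : X → X → ℝ) (S : Set X) : Prop :=
  ∀ x ∈ S, ∀ᶠ y in 𝓝[S] x, ∀ᶠ z in 𝓝[S] y, w x z = w x y + w y z

/-- `f` is a primitive of `w` on `S`. -/
def IsPrimitiveOn {X : Type*} [TopologicalSpace X] (w : X → X → ℝ) (f : X → ℝ) (S : Set X) :
    Prop :=
  ∀ x ∈ S, ∀ᶠ z in 𝓝[S] x, f z = f x + w x z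

/-- The étale space of the local primitives of `w`. -/
@[nolint unusedArguments]
def GermSpace {X : Type*} (_w : X → X → ℝ) : Type _ := X × ℝ

namespace GermSpace

variable {X : Type*} [TopologicalSpace X] {w : X → X → ℝ}

/-- A set is open when it contains, with each point, the germ of the local primitive through it. In
this form the axioms of a topology hold for any `w`; the cocycle rule is needed only for the
covering property. -/
instance : TopologicalSpace (GermSpace w) where
  IsOpen O := ∀ x r, ((x, r) : X × ℝ) ∈ O → ∀ᶠ z in 𝓝 x, ((z, r + w x z) : X × ℝ) ∈ O
  isOpen_univ := fun _ _ _ => Eventually.of_forall fun _ => trivial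
  isOpen_inter := fun _ _ h₁ h₂ x r h => (h₁ x r h.1).and (h₂ x r h.2)
  isOpen_sUnion := fun _ h x r ⟨O, hO, hx⟩ => (h O hO x r hx).mono fun _ hz => ⟨O, hO, hz⟩

theorem isOpen_iff {O : Set (GermSpace w)} :
    IsOpen O ↔ ∀ x r, ((x, r) : X × ℝ) ∈ O → ∀ᶠ z in 𝓝 x, ((z, r + w x z) : X × ℝ) ∈ O :=
  Iff.rfl

theorem continuous_fst : Continuous (fun e : GermSpace w => e.1) := by
  refine continuous_def.2 fun U hU => isOpen_iff.2 fun x r h => ?_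
  exact hU.mem_nhds h

/-- Local form of the étale space. -/
theorem isCoveringMap_fst (hw : IsGermCocycle w) : IsCoveringMap (fun e : GermSpace w => e.1) := by
  intro x₀
  -- The fibre consists of the possible constants of integration, so it is discrete.
  let : TopologicalSpace ℝ := ⊥
  have hd : DiscreteTopology ℝ := ⟨rfl⟩
  suffices IsEvenlyCovered (fun e : GermSpace w => e.1) x₀ ℝ from this.to_isEvenlyCovered_preimage
  obtain ⟨U, hU, hUo, hxU⟩ := eventually_nhds_iff.1 (hw x₀)
  refine ⟨hd, U, hxU, hUo, hUo.preimage continuous_fst, ?_⟩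
  -- Over `U` the sheets are the graphs of `w x₀ + const`. Subtracting `w x₀` straightens them, and
  -- the cocycle rule makes both directions continuous.
  refine ⟨⟨⟨fun e => (⟨e.1.1, e.2⟩, e.1.2 - w x₀ e.1.1), fun y => ⟨(y.1.1, y.2 + w x₀ y.1.1), y.1.2⟩,
    fun e => ?_, fun y => ?_⟩, ?_, ?_⟩, fun _ => rfl⟩
  · apply Subtype.ext
    exact Prod.ext rfl (sub_add_cancel _ _)
  · exact Prod.ext rfl (add_sub_cancel_right _ _)
  · refine Continuous.prodMk (Continuous.subtype_mk (continuous_fst.comp continuous_subtype_val) _) ?_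
    refine continuous_discrete_rng.2 fun c => ?_
    rw [isOpen_induced_iff]
    refine ⟨{e | e.1 ∈ U ∧ e.2 - w x₀ e.1 = c}, isOpen_iff.2 ?_, ?_⟩
    · rintro x r ⟨hx, hr⟩
      filter_upwards [hUo.mem_nhds hx, hU x hx] with z hz hz'
      refine ⟨hz, ?_⟩
      change r + w x z - w x₀ z = c
      change r - w x₀ x = c at hr
      rw [hz', ← hr]; ring
    · ext e
      exact ⟨fun h => h.2, fun h => ⟨e.2, h⟩⟩
  · refine Continuous.subtype_mk ?_ _
    refine continuous_prod_of_discrete_right.2 fun c => ?_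
    refine continuous_def.2 fun O hO => ?_
    rw [isOpen_iff_mem_nhds]
    rintro ⟨x, hx⟩ hxO
    have h1 := isOpen_iff.1 hO _ _ hxO
    have h2 := h1.and (hU x hx)
    rw [nhds_subtype_eq_comap]
    refine (h2.comap Subtype.val).mono ?_
    rintro ⟨z, hz⟩ ⟨h3, h4⟩
    change ((z, c + w x₀ z) : X × ℝ) ∈ O
    change ((z, c + w x₀ x + w x z) : X × ℝ) ∈ O at h3
    rw [h4, ← add_assoc]
    exact h3

end GermSpace

/-- A primitive is a continuous section of the étale space. To find one, the contraction of `X`, run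
backwards from the constant map to the identity, is lifted to this covering; its final stage is a
section. -/
theorem IsGermCocycle.exists_primitive {X : Type*} [TopologicalSpace X] [ContractibleSpace X]
    {w : X → X → ℝ} (hw : IsGermCocycle w) : ∃ f : X → ℝ, ∀ x, ∀ᶠ z in 𝓝 x, f z = f x + w x z := by
  obtain ⟨x₀, ⟨H⟩⟩ := id_nullhomotopic X
  have cov := GermSpace.isCoveringMap_fst hw
  let e₀ : GermSpace w := ((x₀, 0) : X × ℝ)
  let K := cov.liftHomotopy (H.symm : C(unitInterval × X, X)) (ContinuousMap.const X e₀)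
    (fun a => by simp; rfl)
  have hK : ∀ x, (K (1, x)).1 = x := fun x => by
    have := congr_fun (cov.liftHomotopy_lifts (H.symm : C(unitInterval × X, X))
      (ContinuousMap.const X e₀) (fun a => by simp; rfl)) (1, x)
    exact this.trans (H.symm.apply_one x)
  refine ⟨fun x => (K (1, x)).2, fun x => ?_⟩
  have hc : Continuous fun x => K (1, x) := by fun_prop
  let O : Set (GermSpace w) :=
    {e | ∀ᶠ z in 𝓝 e.1, e.2 + w e.1 z = (K (1, x)).2 + w x z} ∩
      {e | e.2 = (K (1, x)).2 + w x e.1 }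
  have hO : O ∈ 𝓝 (K (1, x)) := by
    obtain ⟨U, hU, hUo, hxU⟩ := eventually_nhds_iff.1 (hw x)
    let O' : Set (GermSpace w) := {e | e.1 ∈ U ∧ e.2 = (K (1, x)).2 + w x e.1}
    -- The cocycle rule at `x`, `x`, `x`.
    have hx0 : w x x = 0 := by
      have := (hU x hxU).self_of_nhds
      linarith
    have hO' : IsOpen O' := GermSpace.isOpen_iff.2 <| by
      rintro y r ⟨hy, hr⟩
      filter_upwards [hUo.mem_nhds hy, hU y hy] with z hz hz'
      refine ⟨hz, ?_⟩
      change r + w y z = (K (1, x)).2 + w x z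
      change r = (K (1, x)).2 + w x y at hr
      rw [hz', hr]; ring
    refine mem_of_superset (hO'.mem_nhds ⟨by rw [hK]; exact hxU, by rw [hK, hx0, add_zero]⟩) ?_
    rintro e ⟨he, he'⟩
    refine ⟨?_, he'⟩
    filter_upwards [hU e.1 he] with z hz
    rw [he', hz]; ring
  filter_upwards [hc.continuousAt hO] with z hz
  have := hz.2
  change (K (1, z)).2 = (K (1, x)).2 + w x (K (1, z)).1 at this
  rw [hK] at this
  exact this

theorem IsGermCocycleOn.exists_primitiveOn_of_starConvex {E : Type*} [AddCommGroup E] [Module ℝ E]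
    [TopologicalSpace E] [ContinuousAdd E] [ContinuousSMul ℝ E] {w : E → E → ℝ} {S : Set E} {c : E}
    (hw : IsGermCocycleOn w S) (hS : StarConvex ℝ c S) (hne : S.Nonempty) :
    ∃ f, IsPrimitiveOn w f S := by
  classical
  have : ContractibleSpace S := hS.contractibleSpace hne
  have h1 : IsGermCocycle (fun x y : S => w x y) := fun x => by
    refine ((eventually_nhds_subtype_iff S x
      (fun y => ∀ᶠ z in 𝓝[S] y, w x z = w x y + w y z)).2 (hw x x.2)).mono fun y hy => ?_
    exact (eventually_nhds_subtype_iff S y (fun z => w x z = w x y + w y z)).2 hy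
  obtain ⟨f, hf⟩ := h1.exists_primitive
  refine ⟨fun x => if h : x ∈ S then f ⟨x, h⟩ else 0, fun x hx => ?_⟩
  refine (eventually_nhds_subtype_iff S ⟨x, hx⟩ _).1 ?_
  filter_upwards [hf ⟨x, hx⟩] with z hz
  simp [hx, hz]

theorem IsPreconnected.apply_eq_of_eventually_eq {X Y : Type*} [TopologicalSpace X] {S : Set X}
    (hS : IsPreconnected S) {f : X → Y} (hf : ∀ x ∈ S, ∀ᶠ z in 𝓝[S] x, f z = f x) {x y : X}
    (hx : x ∈ S) (hy : y ∈ S) : f x = f y := by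
  have := isPreconnected_iff_preconnectedSpace.1 hS
  have h : IsLocallyConstant fun x : S => f x := by
    refine (IsLocallyConstant.iff_eventually_eq _).2 fun x => ?_
    exact (eventually_nhds_subtype_iff S x (fun z => f z = f x)).2 (hf x x.2)
  exact h.apply_eq_of_preconnectedSpace ⟨x, hx⟩ ⟨y, hy⟩

/-- The Mayer–Vietoris step: on the connected overlap two primitives differ by a constant, so one of
them can be shifted to match the other. -/
theorem exists_primitiveOn_union {X : Type*} [TopologicalSpace X] {w : X → X → ℝ}
    {S A B : Set X} (hA : IsOpen A) (hB : IsOpen B) (hS : S ⊆ A ∪ B)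
    (hAB : IsPreconnected (S ∩ (A ∩ B))) {f g : X → ℝ}
    (hf : IsPrimitiveOn w f (S ∩ A)) (hg : IsPrimitiveOn w g (S ∩ B)) :
    ∃ h, IsPrimitiveOn w h S := by
  classical
  obtain ⟨c, hc⟩ : ∃ c, ∀ x ∈ S ∩ (A ∩ B), f x = g x + c := by
    rcases (S ∩ (A ∩ B)).eq_empty_or_nonempty with h | ⟨x₀, hx₀⟩
    · exact ⟨0, by simp [h]⟩
    · refine ⟨f x₀ - g x₀, fun x hx => ?_⟩
      have := hAB.apply_eq_of_eventually_eq (f := fun x => f x - g x) (fun x hx => ?_) hx hx₀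
      · linarith
      · have h1 := nhdsWithin_mono x (s := S ∩ (A ∩ B)) (t := S ∩ A) (by grind) (hf x (by grind))
        have h2 := nhdsWithin_mono x (s := S ∩ (A ∩ B)) (t := S ∩ B) (by grind) (hg x (by grind))
        filter_upwards [h1, h2] with z hz hz'
        rw [hz, hz']; ring
  refine ⟨fun x => if x ∈ A then f x else g x + c, fun x hx => ?_⟩
  by_cases hxA : x ∈ A
  · have h1 := hf x ⟨hx, hxA⟩
    rw [nhdsWithin_inter_of_mem' (mem_nhdsWithin_of_mem_nhds (hA.mem_nhds hxA))] at h1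
    filter_upwards [h1, mem_nhdsWithin_of_mem_nhds (hA.mem_nhds hxA)] with z hz hzA
    simp [hxA, hzA, hz]
  · have hxB : x ∈ B := (hS hx).resolve_left hxA
    have h1 := hg x ⟨hx, hxB⟩
    rw [nhdsWithin_inter_of_mem' (mem_nhdsWithin_of_mem_nhds (hB.mem_nhds hxB))] at h1
    filter_upwards [h1, mem_nhdsWithin_of_mem_nhds (hB.mem_nhds hxB), self_mem_nhdsWithin]
      with z hz hzB hzS
    by_cases hzA : z ∈ A
    · simp only [hxA, hzA, if_true, if_false, hc z ⟨hzS, hzA, hzB⟩, hz]; ring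
    · simp only [hxA, hzA, if_false, hz]; ring

theorem IsGermCocycleOn.mono {X : Type*} [TopologicalSpace X] {w : X → X → ℝ} {S S' : Set X}
    (hw : IsGermCocycleOn w S) (h : S' ⊆ S) : IsGermCocycleOn w S' := fun x hx =>
  nhdsWithin_mono x h ((hw x (h hx)).mono fun y hy => nhdsWithin_mono y h hy)

theorem IsGermCocycleOn.comp {X Y : Type*} [TopologicalSpace X] [TopologicalSpace Y]
    {w : Y → Y → ℝ} {S : Set X} {S' : Set Y} (hw : IsGermCocycleOn w S') {φ : X → Y}
    (hφ : ContinuousOn φ S) (h : MapsTo φ S S') :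
    IsGermCocycleOn (fun x y => w (φ x) (φ y)) S := by
  have ht : ∀ x ∈ S, Tendsto φ (𝓝[S] x) (𝓝[S'] (φ x)) := fun x hx =>
    (hφ x hx).tendsto_nhdsWithin h
  intro x hx
  filter_upwards [(ht x hx).eventually (hw _ (h hx)), self_mem_nhdsWithin] with y hy hyS
  exact (ht y hyS).eventually hy

/-! ### First cohomology of punctured convex sets and punctured manifold neighbourhoods. -/

/-- Off the line, `K` is covered by four convex pieces cut out by strict inequalities on the
coordinates 0 and 2; midpoints show that neighbouring pieces meet. No point on the negative side of
coordinate 0 is assumed, because `c` may lie on the boundary of a half-space; that piece may be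
empty. -/
theorem isPreconnected_convex_diff_line {K : Set (EuclideanSpace ℝ (Fin 3))} (hK : Convex ℝ K)
    {c : EuclideanSpace ℝ (Fin 3)} {ε : ℝ} (hε : 0 < ε)
    (h0 : c + EuclideanSpace.single 0 ε ∈ K) (h2 : c + EuclideanSpace.single 2 ε ∈ K)
    (h2' : c + EuclideanSpace.single 2 (-ε) ∈ K) :
    IsPreconnected (K ∩ {x | x 0 ≠ c 0 ∨ x 2 ≠ c 2}) := by
  have key : ∀ (l : EuclideanSpace ℝ (Fin 3) →ₗ[ℝ] ℝ) (a : ℝ),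
      IsPreconnected (K ∩ {x | a < l x}) := fun l a =>
    (hK.inter (convex_halfSpace_gt l.isLinear a)).isPreconnected
  let l (i : Fin 3) : EuclideanSpace ℝ (Fin 3) →ₗ[ℝ] ℝ := (EuclideanSpace.proj i).toLinearMap
  have pos (i) : IsPreconnected (K ∩ {x | c i < x i}) := key (l i) (c i)
  have neg (i) : IsPreconnected (K ∩ {x | x i < c i}) := by
    have := key (-l i) (-c i)
    convert this using 4
    simp [l]
  have hmid : ∀ x ∈ K, ∀ y ∈ K, (1 / 2 : ℝ) • x + (1 / 2 : ℝ) • y ∈ K := fun x hx y hy =>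
    hK hx hy (by norm_num) (by norm_num) (by norm_num)
  have u2 : IsPreconnected (K ∩ {x | c 0 < x 0} ∪ K ∩ {x | c 2 < x 2}) := by
    refine (pos 0).union' ⟨_, ⟨hmid _ h0 _ h2, ?_⟩, ⟨hmid _ h0 _ h2, ?_⟩⟩ (pos 2)
    all_goals simp; linarith
  have u2' : IsPreconnected (K ∩ {x | c 0 < x 0} ∪ K ∩ {x | x 2 < c 2}) := by
    refine (pos 0).union' ⟨_, ⟨hmid _ h0 _ h2', ?_⟩, ⟨hmid _ h0 _ h2', ?_⟩⟩ (neg 2)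
    all_goals simp; linarith
  refine isPreconnected_of_forall (c + EuclideanSpace.single 0 ε) ?_
  rintro y ⟨hy, hy'⟩
  have hx : c + EuclideanSpace.single 0 ε ∈ K ∩ {x | c 0 < x 0} := ⟨h0, by simpa using hε⟩
  have s0 : K ∩ {x | c 0 < x 0} ⊆ K ∩ {x | x 0 ≠ c 0 ∨ x 2 ≠ c 2} :=
    fun x hx => ⟨hx.1, Or.inl hx.2.ne'⟩
  have s0' : K ∩ {x | x 0 < c 0} ⊆ K ∩ {x | x 0 ≠ c 0 ∨ x 2 ≠ c 2} :=
    fun x hx => ⟨hx.1, Or.inl hx.2.ne⟩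
  have s2 : K ∩ {x | c 2 < x 2} ⊆ K ∩ {x | x 0 ≠ c 0 ∨ x 2 ≠ c 2} :=
    fun x hx => ⟨hx.1, Or.inr hx.2.ne'⟩
  have s2' : K ∩ {x | x 2 < c 2} ⊆ K ∩ {x | x 0 ≠ c 0 ∨ x 2 ≠ c 2} :=
    fun x hx => ⟨hx.1, Or.inr hx.2.ne⟩
  rcases lt_trichotomy (y 2) (c 2) with h | h | h
  · exact ⟨_, union_subset s0 s2', Or.inl hx, Or.inr ⟨hy, h⟩, u2'⟩
  · rcases lt_trichotomy (y 0) (c 0) with h' | h' | h'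
    · have hm : (1 / 2 : ℝ) • y + (1 / 2 : ℝ) • (c + EuclideanSpace.single 2 ε) ∈
          {x | x 0 < c 0} ∩ {x | c 2 < x 2} := by
        constructor
        · simp; linarith
        · simp; linarith
      have u3 := u2.union' (t := K ∩ {x | x 0 < c 0})
        ⟨_, Or.inr ⟨hmid _ hy _ h2, hm.2⟩, hmid _ hy _ h2, hm.1⟩ (neg 0)
      exact ⟨_, union_subset (union_subset s0 s2) s0', Or.inl (Or.inl hx), Or.inr ⟨hy, h'⟩, u3⟩
    · simp_all
    · exact ⟨_, s0, hx, ⟨hy, h'⟩, pos 0⟩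
  · exact ⟨_, union_subset s0 s2, Or.inl hx, Or.inr ⟨hy, h⟩, u2⟩

/-- The centre lies on the opposite half of the same line, so a segment from it runs into the ray
only if its endpoint is on the ray. The sign of `σ` selects the half. -/
theorem starConvex_convex_diff_ray {K : Set (EuclideanSpace ℝ (Fin 3))} (hK : Convex ℝ K)
    {c : EuclideanSpace ℝ (Fin 3)} {ε : ℝ} (σ : ℝ) (hε : 0 < σ * ε)
    (h1 : c + EuclideanSpace.single 1 ε ∈ K) :
    StarConvex ℝ (c + EuclideanSpace.single 1 ε)
      (K ∩ {x | x 0 = c 0 ∧ x 2 = c 2 ∧ σ * x 1 ≤ σ * c 1}ᶜ) := by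
  rintro y ⟨hy, hy'⟩ a b ha hb hab
  refine ⟨hK h1 hy ha hb hab, ?_⟩
  rintro ⟨z0, z2, z1⟩
  simp at z0 z1 z2 hy'
  obtain rfl : a = 1 - b := by linarith
  rcases hb.eq_or_lt with rfl | hb
  · nlinarith
  · have y0 : y 0 = c 0 := mul_left_cancel₀ hb.ne' (by linarith)
    have y2 : y 2 = c 2 := mul_left_cancel₀ hb.ne' (by linarith)
    have := hy' y0 y2
    nlinarith [mul_nonneg ha hε.le, mul_pos hb (sub_pos.2 this)]

/-- A convex set of dimension three, minus one of its points (in its interior or in a flat part of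
its boundary), has no first cohomology. -/
theorem IsGermCocycleOn.exists_primitiveOn_convex_diff_singleton
    {K : Set (EuclideanSpace ℝ (Fin 3))} (hK : Convex ℝ K)
    {c : EuclideanSpace ℝ (Fin 3)} {ε : ℝ} (hε : 0 < ε)
    (h0 : c + EuclideanSpace.single 0 ε ∈ K) (h1 : c + EuclideanSpace.single 1 ε ∈ K)
    (h1' : c + EuclideanSpace.single 1 (-ε) ∈ K) (h2 : c + EuclideanSpace.single 2 ε ∈ K)
    (h2' : c + EuclideanSpace.single 2 (-ε) ∈ K) {w : EuclideanSpace ℝ (Fin 3) → _ → ℝ}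
    (hw : IsGermCocycleOn w (K \ {c})) : ∃ f, IsPrimitiveOn w f (K \ {c}) := by
  have hcl (σ : ℝ) : IsOpen {x : EuclideanSpace ℝ (Fin 3) |
      x 0 = c 0 ∧ x 2 = c 2 ∧ σ * x 1 ≤ σ * c 1}ᶜ := by
    have h (i : Fin 3) : Continuous fun x : EuclideanSpace ℝ (Fin 3) => x i := by fun_prop
    exact ((isClosed_eq (h 0) continuous_const).inter ((isClosed_eq (h 2) continuous_const).inter
      (isClosed_le ((h 1).const_mul σ) continuous_const))).isOpen_compl
  -- The two opposite rays from `c` in direction 1 are removed one at a time. The two star-shaped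
  -- complements cover `K \ {c}`, and they overlap in `K` minus a line.
  have side (σ ε : ℝ) (hε : 0 < σ * ε) (h1 : c + EuclideanSpace.single 1 ε ∈ K) :
      ∃ f, IsPrimitiveOn w f
        ((K \ {c}) ∩ {x | x 0 = c 0 ∧ x 2 = c 2 ∧ σ * x 1 ≤ σ * c 1}ᶜ) := by
    have e : (K \ {c}) ∩ {x | x 0 = c 0 ∧ x 2 = c 2 ∧ σ * x 1 ≤ σ * c 1}ᶜ =
        K ∩ {x | x 0 = c 0 ∧ x 2 = c 2 ∧ σ * x 1 ≤ σ * c 1}ᶜ := by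
      ext x
      constructor
      · rintro ⟨⟨h, -⟩, h'⟩
        exact ⟨h, h'⟩
      · rintro ⟨h, h'⟩
        refine ⟨⟨h, ?_⟩, h'⟩
        rintro rfl
        simp at h'
    have hsub := e ▸ (inter_subset_left :
      (K \ {c}) ∩ {x | x 0 = c 0 ∧ x 2 = c 2 ∧ σ * x 1 ≤ σ * c 1}ᶜ ⊆ _)
    rw [e]
    refine IsGermCocycleOn.exists_primitiveOn_of_starConvex (hw.mono hsub)
      (starConvex_convex_diff_ray hK σ hε h1) ⟨_, h1, ?_⟩
    simp; nlinarith
  obtain ⟨f, hf⟩ := side 1 ε (by linarith) h1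
  obtain ⟨g, hg⟩ := side (-1) (-ε) (by linarith) h1'
  refine exists_primitiveOn_union (hcl 1) (hcl (-1)) ?_ ?_ hf hg
  · rintro x ⟨-, hx⟩
    by_contra h
    simp at h
    apply hx
    ext i
    fin_cases i
    · exact h.1.1
    · exact le_antisymm h.1.2.2 h.2.2.2
    · exact h.1.2.1
  · convert isPreconnected_convex_diff_line hK hε h0 h2 h2' using 1
    ext x
    simp
    constructor
    · grind
    · rintro ⟨hx, h⟩
      refine ⟨⟨hx, ?_⟩, by grind, by grind⟩
      rintro rfl
      simp at h

open scoped Manifold in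
/-- In a three-manifold, possibly with boundary, small punctured neighbourhoods have no first
cohomology. -/
theorem exists_primitiveOn_punctured_nhds {X : Type*} [TopologicalSpace X]
    [ChartedSpace (EuclideanHalfSpace 3) X] {w : X → X → ℝ} {p : X} {W : Set X} (hW : W ∈ 𝓝 p)
    (hw : IsGermCocycleOn w (W \ {p})) :
    ∃ V, IsOpen V ∧ p ∈ V ∧ V ⊆ W ∧ ∃ f, IsPrimitiveOn w f (V \ {p}) := by
  let e := extChartAt (𝓡∂ 3) p
  have hp : p ∈ e.source := mem_extChartAt_source p
  have hpt : e p ∈ e.target := e.map_source hp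
  have hps : e.symm (e p) = p := e.left_inv hp
  have hrange : range (𝓡∂ 3) = {y : EuclideanSpace ℝ (Fin 3) | 0 ≤ y 0} :=
    range_euclideanHalfSpace 3
  have hnhds : e.target ∩ e.symm ⁻¹' W ∈ 𝓝[range (𝓡∂ 3)] e p :=
    inter_mem (extChartAt_target_mem_nhdsWithin p) (nhdsWithin_le_nhds (extChartAt_preimage_mem_nhds hW))
  obtain ⟨r, hr, hK⟩ := Metric.mem_nhdsWithin_iff.1 hnhds
  let K := Metric.ball (e p) r ∩ range (𝓡∂ 3)
  have hmem : ∀ x ∈ e.source, e x ∈ range (𝓡∂ 3) := fun x hx =>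
    extChartAt_target_subset_range p (e.map_source hx)
  have hconv : Convex ℝ K := by
    refine (convex_ball _ _).inter ?_
    rw [hrange]
    exact EuclideanHalfSpace.convex
  have hc0 : 0 ≤ e p 0 := by
    have := hmem p hp
    rwa [hrange] at this
  -- Coordinate 0 is the one bounded below in the half-space model, so only non-negative steps are
  -- available in that direction.
  have hin (i : Fin 3) (ε : ℝ) (h : |ε| < r) (h' : i = 0 → 0 ≤ ε) :
      e p + EuclideanSpace.single i ε ∈ K := by
    refine ⟨by simpa using h, ?_⟩
    rw [hrange]
    by_cases hi : i = 0
    · subst hi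
      have := h' rfl
      simp; linarith
    · simp [Ne.symm hi, hc0]
  have hr2 : |r / 2| < r := by rw [abs_of_pos (by linarith)]; linarith
  have hne : ∀ z ∈ K \ {e p}, e.symm z ∈ W \ {p} := by
    rintro z ⟨hz, hz'⟩
    refine ⟨(hK hz).2, fun h => hz' ?_⟩
    rw [mem_singleton_iff] at h ⊢
    rw [← e.right_inv (hK hz).1, h]
  obtain ⟨f, hf⟩ := IsGermCocycleOn.exists_primitiveOn_convex_diff_singleton hconv (ε := r / 2)
    (by linarith) (hin 0 _ hr2 fun _ => by linarith) (hin 1 _ hr2 (by simp))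
    (hin 1 _ (by rwa [abs_neg]) (by simp)) (hin 2 _ hr2 (by simp))
    (hin 2 _ (by rwa [abs_neg]) (by simp))
    (hw.comp ((continuousOn_extChartAt_symm p).mono fun z hz => (hK hz.1).1) hne)
  have hVo : IsOpen (e.source ∩ e ⁻¹' Metric.ball (e p) r) :=
    (continuousOn_extChartAt p).isOpen_inter_preimage (isOpen_extChartAt_source p)
      Metric.isOpen_ball
  refine ⟨e.source ∩ e ⁻¹' Metric.ball (e p) r, hVo, ⟨hp, Metric.mem_ball_self hr⟩, ?_, f ∘ e, ?_⟩
  · rintro x ⟨hx, hx'⟩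
    have := (hK ⟨hx', hmem x hx⟩).2
    rwa [mem_preimage, e.left_inv hx] at this
  · have hmaps : MapsTo e ((e.source ∩ e ⁻¹' Metric.ball (e p) r) \ {p}) (K \ {e p}) := by
      rintro x ⟨⟨hx, hx'⟩, hxp⟩
      exact ⟨⟨hx', hmem x hx⟩, fun h => hxp (e.injOn hx hp h)⟩
    rintro x hx
    have ht : Tendsto e (𝓝[(e.source ∩ e ⁻¹' Metric.ball (e p) r) \ {p}] x) (𝓝[K \ {e p}] (e x)) :=
      ((continuousOn_extChartAt p x hx.1.1).mono fun z hz => hz.1.1).tendsto_nhdsWithin hmaps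
    filter_upwards [ht.eventually (hf _ (hmaps hx)), self_mem_nhdsWithin] with z hz hzV
    rw [e.left_inv hx.1.1, e.left_inv hzV.1.1] at hz
    exact hz

/-! ### Potentials along partial injections and at the corners of the vertex links. -/

/-- A real cochain on the arrows of a partial injection of a finite set that vanishes on all
cycles is a coboundary. -/
theorem exists_potential_of_sum_cycle_eq_zero {α : Type*} [Finite α] {next : α → Option α}
    (inj : ∀ x y z, next x = some z → next y = some z → x = y) (d : α → α → ℝ)
    (hd : ∀ (m : ℕ) (x : ℕ → α), 0 < m → (∀ r < m, next (x r) = some (x (r + 1))) → x m = x 0 →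
      InjOn x (Iio m) → ∑ r ∈ Finset.range m, d (x r) (x (r + 1)) = 0) :
    ∃ U : α → ℝ, ∀ x y, next x = some y → U y = U x + d x y := by
  classical
  let σ : α → α := fun x => (next x).getD x
  have hσ : ∀ x y, next x = some y → σ x = y := fun x y h => by simp [σ, h]
  let e : α → ℕ → ℝ := fun x r => d (σ^[r] x) (σ^[r + 1] x)
  have he : ∀ x r, e (σ x) r = e x (r + 1) := fun x r => by simp [e]
  let m : α → ℕ := Function.minimalPeriod σ
  -- On an orbit that stops, the potential is minus the sum of `d` up to the end. On a cycle there
  -- is no distinguished base point, so the partial sums are averaged over one turn; moving the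
  -- start shifts this average by `d` because the full sum is zero.
  refine ⟨fun x => if h : ∃ k, next (σ^[k] x) = none then
    - ∑ r ∈ Finset.range (Nat.find h), e x r else
    - (∑ k ∈ Finset.range (m x), ∑ r ∈ Finset.range k, e x r) / m x, fun x y hxy => ?_⟩
  obtain rfl := hσ x y hxy
  have hx0 : d x (σ x) = e x 0 := rfl
  by_cases h : ∃ k, next (σ^[k] x) = none
  · have h' : ∃ k, next (σ^[k + 1] x) = none := by
      obtain ⟨k, hk⟩ := h
      cases k with
      | zero => simp [hxy] at hk
      | succ k => exact ⟨k, hk⟩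
    have h'' : ∃ k, next (σ^[k] (σ x)) = none := h'
    have hfind : Nat.find h = Nat.find h'' + 1 := Nat.find_comp_succ h h' (by simp [hxy])
    beta_reduce
    rw [dif_pos h, dif_pos h'', hfind, Finset.sum_range_succ', hx0]
    simp only [he]
    ring
  · have h'' : ¬ ∃ k, next (σ^[k] (σ x)) = none := fun ⟨k, hk⟩ => h ⟨k + 1, hk⟩
    beta_reduce
    rw [dif_neg h, dif_neg h'']
    have hnext : ∀ k, next (σ^[k] x) = some (σ^[k + 1] x) := fun k => by
      obtain ⟨z, hz⟩ := Option.ne_none_iff_exists'.1 fun hk => h ⟨k, hk⟩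
      rw [hz, Function.iterate_succ_apply', hσ _ _ hz]
    -- Injectivity lets steps be cancelled, so a repetition far along an orbit that never stops
    -- already makes its starting point periodic.
    have hback : ∀ a k, σ^[a] x = σ^[a + k] x → x = σ^[k] x := by
      intro a
      induction a with
      | zero => intro k hk; simpa using hk
      | succ a ih =>
        intro k hk
        refine ih k (inj _ _ _ (hnext a) ?_)
        rw [hk, hnext]
        congr 2; omega
    have hper : x ∈ Function.periodicPts σ := by
      obtain ⟨a, b, hab, h⟩ := Finite.exists_ne_map_eq_of_infinite fun k => σ^[k] x
      rcases lt_or_gt_of_ne hab with hlt | hlt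
      · obtain ⟨k, rfl⟩ := Nat.exists_eq_add_of_lt hlt
        exact ⟨k + 1, by omega, (hback a (k + 1) h).symm⟩
      · obtain ⟨k, rfl⟩ := Nat.exists_eq_add_of_lt hlt
        exact ⟨k + 1, by omega, (hback b (k + 1) h.symm).symm⟩
    have hm : 0 < m x := Function.minimalPeriod_pos_of_mem_periodicPts hper
    have hmx : m (σ x) = m x := Function.minimalPeriod_apply hper
    have hsum : ∑ r ∈ Finset.range (m x), e x r = 0 :=
      hd (m x) (fun r => σ^[r] x) hm (fun r _ => hnext r) (by
        simp only [Function.iterate_zero, id]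
        exact Function.iterate_minimalPeriod) Function.iterate_injOn_Iio_minimalPeriod
    have hS : ∀ k, ∑ r ∈ Finset.range k, e (σ x) r = ∑ r ∈ Finset.range (k + 1), e x r - e x 0 :=
      fun k => by simp [Finset.sum_range_succ', he]
    have hshift := Finset.sum_range_succ (fun k => ∑ r ∈ Finset.range k, e x r) (m x)
    rw [Finset.sum_range_succ', hsum] at hshift
    simp only [Finset.range_zero, Finset.sum_empty, add_zero] at hshift
    rw [hmx, hx0]
    simp only [hS, Finset.sum_sub_distrib, Finset.sum_const, Finset.card_range, nsmul_eq_mul, hshift]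
    have : (m x : ℝ) ≠ 0 := by exact_mod_cast hm.ne'
    field_simp
    ring

namespace NormalSurface

theorem Gluing.next_eq_some {n : ℕ} {T : Gluing n} {x : EdgeFlag n} {j : Fin n}
    {p : Equiv.Perm (Fin 4)} (h : T.glue x.1 (x.2 3) = some (j, p)) :
    T.next x = some (j, p * x.2 * Equiv.swap 2 3) := by
  simp [Gluing.next, h]

/-- The flag arrived at records the face of entry, and by `Gluing.symm` the gluing across that face
leads back. -/
theorem Gluing.next_injective {n : ℕ} (T : Gluing n) (x y z : EdgeFlag n)
    (hx : T.next x = some z) (hy : T.next y = some z) : x = y := by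
  obtain ⟨i, s⟩ := x
  obtain ⟨i', s'⟩ := y
  simp only [Gluing.next, Option.map_eq_some_iff, Prod.exists] at hx hy
  obtain ⟨j, p, hp, rfl⟩ := hx
  obtain ⟨j', p', hp', h⟩ := hy
  simp only [Prod.mk.injEq, mul_left_inj] at h
  obtain ⟨rfl, h⟩ := h
  have h1 := T.symm _ _ _ _ hp
  have h2 := T.symm _ _ _ _ hp'
  have h3 : p' (s' 3) = p (s 3) := DFunLike.congr_fun h 3
  rw [h3, h1] at h2
  simp only [Option.some.injEq, Prod.mk.injEq, inv_inj] at h2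
  obtain ⟨rfl, rfl⟩ := h2
  rw [mul_right_inj] at h
  rw [h]

/-- A solution of the quadrilateral matching equations has a potential at the corners of the
vertex links. -/
theorem QuadMatching.exists_corner_potential {n : ℕ} {T : Gluing n} {q : QuadVec n}
    (hq : QuadMatching T q) : ∃ u : Fin n → Fin 4 → Fin 4 → ℝ,
      ∀ i f j p, T.glue i f = some (j, p) → ∀ a b, a ≠ b → a ≠ f → b ≠ f →
        u j (p a) (p b) = u i a b + (q (i, quadSep a f) - q (j, quadSep (p a) (p f))) := by
  classical
  obtain ⟨U, hU⟩ := exists_potential_of_sum_cycle_eq_zero T.next_injective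
    -- Both terms belong to the face crossed from `x` to `y`. Around a cycle the sum is that of the
    -- quadrilateral equation after a cyclic shift of the upward terms.
    (fun x y => q (downward x) - q (upward y)) (fun m x hm h1 h2 h3 => by
      have h4 := hq m x ⟨hm, h1, h2, h3⟩
      have h5 := Finset.sum_range_succ (fun r => q (upward (x r))) m
      rw [Finset.sum_range_succ', h2] at h5
      rw [Finset.sum_sub_distrib]
      linarith)
  have hperm : ∀ a b f : Fin 4, a ≠ b → a ≠ f → b ≠ f →
      ∃ s : Equiv.Perm (Fin 4), s 0 = a ∧ s 1 = b ∧ s 3 = f := by decide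
  have hfix : ∀ t : Equiv.Perm (Fin 4), t 0 = 0 → t 1 = 1 → t = 1 ∨ t = Equiv.swap 2 3 := by decide
  -- A corner of a link carries no direction of rotation, while a flag does. The values at its two
  -- flags are averaged; crossing a face gives the same increment along one direction as backwards
  -- along the other.
  let u : Fin n → Fin 4 → Fin 4 → ℝ := fun i a b =>
    if h : ∃ s : Equiv.Perm (Fin 4), s 0 = a ∧ s 1 = b then
      (U (i, h.choose) + U (i, h.choose * Equiv.swap 2 3)) / 2 else 0
  have hu : ∀ i (s : Equiv.Perm (Fin 4)),
      u i (s 0) (s 1) = (U (i, s) + U (i, s * Equiv.swap 2 3)) / 2 := by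
    intro i s
    have h : ∃ s' : Equiv.Perm (Fin 4), s' 0 = s 0 ∧ s' 1 = s 1 := ⟨s, rfl, rfl⟩
    simp only [u, dif_pos h]
    have h1 := h.choose_spec
    revert h1
    generalize h.choose = s'
    intro h1
    rcases hfix (s⁻¹ * s') (by simp [h1.1]) (by simp [h1.2]) with h2 | h2
    · obtain rfl := inv_mul_eq_one.1 h2
      rfl
    · rw [inv_mul_eq_iff_eq_mul] at h2
      rw [h2, mul_assoc, Equiv.swap_mul_self, mul_one, add_comm]
  refine ⟨u, fun i f j p hp a b hab haf hbf => ?_⟩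
  obtain ⟨s, rfl, rfl, rfl⟩ := hperm a b f hab haf hbf
  have e1 := hU _ _ (Gluing.next_eq_some (x := (i, s)) hp)
  have e2 := hU _ _ (Gluing.next_eq_some (x := (j, p * s)) (j := i) (p := p⁻¹)
    (by exact T.symm i (s 3) j p hp))
  have e3 := hu j (p * s)
  rw [hu i s]
  simp only [inv_mul_cancel_left, downward, upward, Equiv.Perm.coe_mul, Function.comp_apply,
    Equiv.swap_apply_left, Equiv.swap_apply_of_ne_of_ne (show (0 : Fin 4) ≠ 2 by decide)
      (show (0 : Fin 4) ≠ 3 by decide)] at e1 e2 e3 ⊢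
  rw [e3, e1]
  linarith
end NormalSurface

/-! ### The quotient space and interpolation near the vertices of the tetrahedra. -/

namespace NormalSurface

variable {n : ℕ}

/-- The disjoint union of the tetrahedra. -/
abbrev Tetrahedra (n : ℕ) : Type := Fin n × stdSimplex ℝ (Fin 4)

/-- Relabel the vertices of the simplex. -/
def permSimplex (p : Equiv.Perm (Fin 4)) (x : stdSimplex ℝ (Fin 4)) : stdSimplex ℝ (Fin 4) :=
  ⟨fun a => x.1 (p⁻¹ a), fun a => x.2.1 _, by rw [Equiv.sum_comp p⁻¹ x.1]; exact x.2.2⟩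

namespace Gluing

/-- The quotient map. -/
def toSpace (T : Gluing n) (x : Tetrahedra n) : T.Space := Quot.mk T.Ident x

theorem toSpace_eq_of_ident {T : Gluing n} {x y : Tetrahedra n} (h : T.Ident x y) :
    T.toSpace x = T.toSpace y :=
  Quot.sound h

theorem toSpace_surjective (T : Gluing n) : Function.Surjective T.toSpace := Quot.exists_rep

theorem continuous_toSpace (T : Gluing n) : Continuous T.toSpace := continuous_quot_mk

theorem isClosedMap_toSpace (T : Gluing n) [T2Space T.Space] : IsClosedMap T.toSpace := by
  have : CompactSpace (stdSimplex ℝ (Fin 4)) := isCompact_iff_compactSpace.1 (isCompact_stdSimplex ℝ _)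
  exact T.continuous_toSpace.isClosedMap

theorem ident_symm {T : Gluing n} {x y : Tetrahedra n} (h : T.Ident x y) : T.Ident y x := by
  obtain ⟨f, p, h1, h2, h3⟩ := h
  exact ⟨p f, p⁻¹, T.symm _ _ _ _ h1, by rw [h3, h2], fun a => by rw [← h3]; simp⟩

theorem ident_permSimplex {T : Gluing n} {i j : Fin n} {f : Fin 4} {p : Equiv.Perm (Fin 4)}
    (h : T.glue i f = some (j, p)) {x : stdSimplex ℝ (Fin 4)} (hx : x.1 f = 0) :
    T.Ident (i, x) (j, permSimplex p x) :=
  ⟨f, p, h, hx, fun a => by simp [permSimplex]⟩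

/-- Every identification permutes barycentric coordinates. Hence fibres are finite, and being near a
vertex depends only on the point of the quotient. -/
theorem exists_perm_of_toSpace_eq {T : Gluing n} {x y : Tetrahedra n}
    (h : T.toSpace x = T.toSpace y) :
    ∃ p : Equiv.Perm (Fin 4), y.2 = permSimplex p x.2 := by
  have h' := Quot.eqvGen_exact h
  clear h
  induction h' with
  | rel x y h =>
    obtain ⟨f, p, h1, h2, h3⟩ := h
    refine ⟨p, Subtype.ext (funext fun a => ?_)⟩
    rw [← p.apply_symm_apply a, h3]
    simp [permSimplex]
  | refl x => exact ⟨1, rfl⟩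
  | symm x y _ ih =>
    obtain ⟨p, hp⟩ := ih
    refine ⟨p⁻¹, ?_⟩
    rw [hp]
    ext a
    simp [permSimplex]
  | trans x y z _ _ ih ih' =>
    obtain ⟨p, hp⟩ := ih
    obtain ⟨p', hp'⟩ := ih'
    refine ⟨p' * p, ?_⟩
    rw [hp', hp]
    ext a
    simp [permSimplex]

theorem finite_fiber (T : Gluing n) (x : Tetrahedra n) :
    {y | T.toSpace y = T.toSpace x}.Finite := by
  refine (Set.finite_range fun z : Fin n × Equiv.Perm (Fin 4) => (z.1, permSimplex z.2 x.2)).subset ?_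
  rintro y (hy : T.toSpace y = T.toSpace x)
  obtain ⟨p, hp⟩ := exists_perm_of_toSpace_eq hy.symm
  exact ⟨(y.1, p), Prod.ext rfl hp.symm⟩

end Gluing

/-- Points of a tetrahedron near a vertex, but different from it. -/
def NearVertex (x : stdSimplex ℝ (Fin 4)) : Prop := ∃ a, 1 / 2 < x.1 a ∧ x.1 a < 1

theorem sum_ite_ne_eq {x : stdSimplex ℝ (Fin 4)} (a : Fin 4) :
    ∑ b, (if b = a then 0 else x.1 b) = 1 - x.1 a := by
  have h : ∀ b, (if b = a then 0 else x.1 b) = x.1 b - if b = a then x.1 b else 0 := fun b => by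
    split_ifs <;> simp
  simp only [h, Finset.sum_sub_distrib, Finset.sum_ite_eq', Finset.mem_univ, if_true]
  rw [show ∑ b, x.1 b = 1 from x.2.2]

theorem add_le_one {x : stdSimplex ℝ (Fin 4)} {a b : Fin 4} (h : a ≠ b) : x.1 a + x.1 b ≤ 1 := by
  have := Finset.sum_le_sum_of_subset_of_nonneg (Finset.subset_univ {a, b})
    (f := x.1) (fun i _ _ => x.2.1 i)
  rw [Finset.sum_pair h, show ∑ b, x.1 b = 1 from x.2.2] at this
  exact this

theorem NearVertex.lt_one {x : stdSimplex ℝ (Fin 4)} (h : NearVertex x) (b : Fin 4) :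
    x.1 b < 1 := by
  obtain ⟨a, h1, h2⟩ := h
  by_cases hab : a = b
  · exact hab ▸ h2
  · linarith [add_le_one (x := x) hab]

theorem nearVertex_permSimplex {x : stdSimplex ℝ (Fin 4)} (h : NearVertex x)
    (p : Equiv.Perm (Fin 4)) : NearVertex (permSimplex p x) := by
  obtain ⟨a, h⟩ := h
  exact ⟨p a, by simpa [permSimplex] using h⟩

/-- The local primitive with the values `u i a b` at the corners `b` of the link triangle around
the vertex `a` of the tetrahedron `i`, interpolated linearly. -/
noncomputable def linkInterp (u : Fin n → Fin 4 → Fin 4 → ℝ) (x : Tetrahedra n) : ℝ :=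
  ∑ a, if 1 / 2 < x.2.1 a then
    ∑ b, (if b = a then 0 else x.2.1 b) / (1 - x.2.1 a) * u x.1 a b else 0

/-- The change of `linkInterp` across a face. -/
theorem linkInterp_sub {u : Fin n → Fin 4 → Fin 4 → ℝ} {i j : Fin n} {f : Fin 4}
    {p : Equiv.Perm (Fin 4)} {c : Fin 4 → ℝ}
    (hu : ∀ a b, a ≠ b → a ≠ f → b ≠ f → u j (p a) (p b) = u i a b + c a)
    {x y : stdSimplex ℝ (Fin 4)} (hxf : x.1 f = 0) (hxy : ∀ a, y.1 (p a) = x.1 a)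
    (hx : ∀ a, x.1 a < 1) :
    linkInterp u (j, y) - linkInterp u (i, x) = ∑ a, if 1 / 2 < x.1 a then c a else 0 := by
  unfold linkInterp
  rw [← Equiv.sum_comp p, ← Finset.sum_sub_distrib]
  refine Finset.sum_congr rfl fun a _ => ?_
  simp only [hxy]
  split_ifs with h
  swap
  · simp
  have haf : a ≠ f := by
    rintro rfl
    rw [hxf] at h
    norm_num at h
  have h1 : 1 - x.1 a ≠ 0 := by linarith [hx a]
  -- After division by `1 - x a` the weights sum to one, so a jump `c a` common to all corners
  -- passes unchanged to the interpolation.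
  have h2 := sum_ite_ne_eq (x := x) a
  rw [← Equiv.sum_comp p, ← Finset.sum_sub_distrib]
  have : ∀ b, ((if p b = p a then 0 else y.1 (p b)) / (1 - x.1 a) * u j (p a) (p b) -
      (if b = a then 0 else x.1 b) / (1 - x.1 a) * u i a b) =
      (if b = a then 0 else x.1 b) * (c a / (1 - x.1 a)) := by
    intro b
    rw [hxy]
    by_cases hba : b = a
    · simp [hba]
    by_cases hbf : b = f
    · simp [hbf, hxf]
    rw [hu a b (Ne.symm hba) haf hbf]
    simp only [EmbeddingLike.apply_eq_iff_eq, hba, if_false]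
    field_simp
    ring
  rw [Finset.sum_congr rfl fun b _ => this b, ← Finset.sum_mul, h2]
  field_simp

/-- `y` is closer than `δ` to `x`. -/
def Close (δ : ℝ) (x y : Tetrahedra n) : Prop := y.1 = x.1 ∧ ∀ a, |y.2.1 a - x.2.1 a| < δ

theorem eventually_close (x : Tetrahedra n) {δ : ℝ} (hδ : 0 < δ) : ∀ᶠ y in 𝓝 x, Close δ x y := by
  have h1 : ∀ᶠ y : Tetrahedra n in 𝓝 x, y.1 = x.1 :=
    continuous_fst.continuousAt.eventually ((isOpen_discrete {x.1}).mem_nhds rfl)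
  refine h1.and (eventually_all.2 fun a => ?_)
  have hc : Continuous fun y : Tetrahedra n => |y.2.1 a - x.2.1 a| :=
    (((continuous_apply a).comp (continuous_subtype_val.comp continuous_snd)).sub
      continuous_const).abs
  exact hc.continuousAt.eventually (gt_mem_nhds (by simpa using hδ))

/-- The fibre is finite, so one `δ` serves all of it: the neighbourhoods of its points are disjoint,
touch only faces through those points, and keep the same nearby vertex. -/
theorem exists_close_const (T : Gluing n) (x₀ : Tetrahedra n) (hx₀ : NearVertex x₀.2) :
    ∃ δ > 0, (∀ x y, T.toSpace x = T.toSpace x₀ → T.toSpace y = T.toSpace x₀ → ∀ z,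
      Close δ x z → Close δ y z → x = y) ∧
      (∀ x, T.toSpace x = T.toSpace x₀ → ∀ y, Close δ x y →
        NearVertex y.2 ∧ ∀ a, (y.2.1 a = 0 → x.2.1 a = 0) ∧
          (1 / 2 < y.2.1 a ↔ 1 / 2 < x.2.1 a)) := by
  have hfin := T.finite_fiber x₀
  have hpos : ∀ᶠ δ : ℝ in 𝓝[>] 0, 0 < δ := self_mem_nhdsWithin
  have hsmall : ∀ ε : ℝ, 0 < ε → ∀ᶠ δ : ℝ in 𝓝[>] 0, δ < ε := fun ε hε =>
    nhdsWithin_le_nhds (gt_mem_nhds hε)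
  have h1 : ∀ᶠ δ : ℝ in 𝓝[>] 0, ∀ x ∈ {y | T.toSpace y = T.toSpace x₀}, ∀ y ∈ {y | T.toSpace y = T.toSpace x₀},
      ∀ z, Close δ x z → Close δ y z → x = y := by
    refine (eventually_all_finite hfin).2 fun x hx => (eventually_all_finite hfin).2 fun y hy => ?_
    by_cases hxy : x = y
    · exact Eventually.of_forall fun _ _ _ _ => hxy
    by_cases h1 : x.1 = y.1
    · have : ∃ a, x.2.1 a ≠ y.2.1 a := by
        by_contra! h
        exact hxy (Prod.ext h1 (Subtype.ext (funext h)))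
      obtain ⟨a, ha⟩ := this
      filter_upwards [hsmall (|x.2.1 a - y.2.1 a| / 2) (by simpa [sub_eq_zero] using ha)]
        with δ hδ z hz hz'
      have := abs_sub_le (x.2.1 a) (z.2.1 a) (y.2.1 a)
      have := hz.2 a
      have := hz'.2 a
      rw [abs_sub_comm (x.2.1 a) (z.2.1 a)] at *
      linarith
    · exact Eventually.of_forall fun _ z hz hz' => absurd (hz.1.symm.trans hz'.1) h1
  have h2 : ∀ᶠ δ : ℝ in 𝓝[>] 0, ∀ x ∈ {y | T.toSpace y = T.toSpace x₀}, ∀ a,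
      (0 < x.2.1 a → δ < x.2.1 a) ∧ (1 / 2 < x.2.1 a → δ < x.2.1 a - 1 / 2) ∧
        (x.2.1 a < 1 → δ < 1 - x.2.1 a) := by
    refine (eventually_all_finite hfin).2 fun x hx => eventually_all.2 fun a => ?_
    have himp : ∀ (P : Prop) (ε : ℝ), (P → 0 < ε) → ∀ᶠ δ : ℝ in 𝓝[>] 0, P → δ < ε := by
      intro P ε h
      by_cases hP : P
      · exact (hsmall ε (h hP)).mono fun _ h _ => h
      · exact Eventually.of_forall fun _ h => absurd h hP
    exact (himp _ _ id).and ((himp _ _ sub_pos.2).and (himp _ _ sub_pos.2))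
  obtain ⟨δ, hδ, h1, h2⟩ := (hpos.and (h1.and h2)).exists
  refine ⟨δ, hδ, fun x y hx hy => h1 x hx y hy, fun x hx y hxy => ?_⟩
  have hx' : NearVertex x.2 := by
    obtain ⟨p, hp⟩ := Gluing.exists_perm_of_toSpace_eq hx.symm
    exact hp ▸ nearVertex_permSimplex hx₀ p
  obtain ⟨a₀, ha₀, ha₀'⟩ := hx'
  obtain ⟨-, h4, h5⟩ := h2 x hx a₀
  have h6 := abs_lt.1 (hxy.2 a₀)
  have h7 : 1 / 2 < y.2.1 a₀ := by linarith [h4 ha₀]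
  refine ⟨⟨a₀, h7, by linarith [h5 ha₀']⟩, fun a => ⟨fun hy0 => ?_, ?_⟩⟩
  · by_contra hne
    have := abs_lt.1 (hxy.2 a)
    linarith [(h2 x hx a).1 (lt_of_le_of_ne (x.2.2.1 a) (Ne.symm hne))]
  · by_cases haa : a = a₀
    · subst haa
      exact iff_of_true h7 ha₀
    · refine iff_of_false ?_ ?_
      · linarith [add_le_one (x := y.2) haa]
      · linarith [add_le_one (x := x.2) haa]

end NormalSurface

/-! ### The cocycle near the vertices and the potential for the triangle coordinates. -/

namespace NormalSurface

variable {n : ℕ}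

/-- The corner values `u` are a potential for the `c i f a`, the increments of `u` across faces. -/
def IsCornerPotential (T : Gluing n) (u : Fin n → Fin 4 → Fin 4 → ℝ)
    (c : Fin n → Fin 4 → Fin 4 → ℝ) : Prop :=
  ∀ i f j p, T.glue i f = some (j, p) → ∀ a b, a ≠ b → a ≠ f → b ≠ f →
    u j (p a) (p b) = u i a b + c i f a

variable {T : Gluing n} {u c : Fin n → Fin 4 → Fin 4 → ℝ}

/-- The increment of `linkInterp` from the nearby fibre point descends to the quotient: across a
face, `linkInterp` jumps by the same amount at a point and at the fibre point next to it. -/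
theorem IsCornerPotential.exists_local_primitive (hu : IsCornerPotential T u c)
    {x₀ : Tetrahedra n} (hx₀ : NearVertex x₀.2) :
    ∃ h : T.Space → ℝ, ∀ x, T.toSpace x = T.toSpace x₀ →
      ∀ᶠ y in 𝓝 x, h (T.toSpace y) = linkInterp u y - linkInterp u x := by
  classical
  obtain ⟨δ, hδ, h1, h2⟩ := exists_close_const T x₀ hx₀
  let g : Tetrahedra n → ℝ := fun y =>
    if h : ∃ x, T.toSpace x = T.toSpace x₀ ∧ Close δ x y then
      linkInterp u y - linkInterp u h.choose else 0
  have hg : ∀ x y, T.toSpace x = T.toSpace x₀ → Close δ x y →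
      g y = linkInterp u y - linkInterp u x := by
    intro x y hx hxy
    have h : ∃ x, T.toSpace x = T.toSpace x₀ ∧ Close δ x y := ⟨x, hx, hxy⟩
    simp only [g, dif_pos h]
    rw [h1 _ _ h.choose_spec.1 hx _ h.choose_spec.2 hxy]
  have step : ∀ x y y', T.toSpace x = T.toSpace x₀ → Close δ x y → T.Ident y y' →
      ∃ x', T.toSpace x' = T.toSpace x₀ ∧ Close δ x' y' ∧
        linkInterp u y' - linkInterp u x' = linkInterp u y - linkInterp u x := by
    rintro ⟨i, x⟩ ⟨i', y⟩ ⟨j, y'⟩ hx hxy ⟨f, p, hp, hyf, hyy⟩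
    obtain ⟨hi, hxy'⟩ := id hxy
    dsimp only at hi hp hyf hyy hxy'
    subst hi
    obtain ⟨hny, h3⟩ := h2 _ hx _ hxy
    have hnx : NearVertex x := (h2 _ hx _ ⟨rfl, fun a => by simpa using hδ⟩).1
    have hxf : x.1 f = 0 := (h3 f).1 hyf
    have hid := Gluing.ident_permSimplex hp hxf
    refine ⟨(j, permSimplex p x), (Gluing.toSpace_eq_of_ident hid).symm.trans hx,
      ⟨rfl, fun a => ?_⟩, ?_⟩
    · have := hxy' (p⁻¹ a)
      rw [← hyy] at this
      simpa [permSimplex] using this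
    · have e1 := linkInterp_sub (u := u) (c := c _ f) (hu _ _ _ _ hp) hyf hyy hny.lt_one
      have e2 := linkInterp_sub (u := u) (c := c _ f) (hu _ _ _ _ hp) hxf
        (y := permSimplex p x) (fun a => by simp [permSimplex]) hnx.lt_one
      have e3 : (∑ a, if 1 / 2 < x.1 a then c i' f a else 0) =
          ∑ a, if 1 / 2 < y.1 a then c i' f a else 0 :=
        Finset.sum_congr rfl fun a _ => if_congr (h3 a).2.symm rfl rfl
      linarith
  refine ⟨Quot.lift g fun y y' hyy => ?_, fun x hx => ?_⟩
  · by_cases h : ∃ x, T.toSpace x = T.toSpace x₀ ∧ Close δ x y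
    · obtain ⟨x, hx, hxy⟩ := h
      obtain ⟨x', hx', hxy', e⟩ := step x y y' hx hxy hyy
      rw [hg _ _ hx hxy, hg _ _ hx' hxy', e]
    · have h' : ¬ ∃ x, T.toSpace x = T.toSpace x₀ ∧ Close δ x y' := fun ⟨x, hx, hxy⟩ => by
        obtain ⟨x', hx', hxy', -⟩ := step x y' y hx hxy (Gluing.ident_symm hyy)
        exact h ⟨x', hx', hxy'⟩
      simp only [g, dif_neg h, dif_neg h']
  · filter_upwards [eventually_close x hδ] with y hy
    exact hg x y hx hy

/-- A germ of a cocycle near the vertices of the triangulation. -/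
theorem IsCornerPotential.exists_germCocycle [T2Space T.Space] (hu : IsCornerPotential T u c) :
    ∃ w : T.Space → T.Space → ℝ,
      (∀ x : Tetrahedra n, NearVertex x.2 → ∀ᶠ y in 𝓝 x,
        w (T.toSpace x) (T.toSpace y) = linkInterp u y - linkInterp u x) ∧
      IsGermCocycleOn w {P | ∃ x : Tetrahedra n, NearVertex x.2 ∧ T.toSpace x = P} := by
  classical
  let w : T.Space → T.Space → ℝ := fun P =>
    if h : ∃ x : Tetrahedra n, NearVertex x.2 ∧ T.toSpace x = P then
      (hu.exists_local_primitive h.choose_spec.1).choose else 0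
  have hw : ∀ x : Tetrahedra n, NearVertex x.2 → ∀ᶠ y in 𝓝 x,
      w (T.toSpace x) (T.toSpace y) = linkInterp u y - linkInterp u x := by
    intro x hx
    have h : ∃ y : Tetrahedra n, NearVertex y.2 ∧ T.toSpace y = T.toSpace x := ⟨x, hx, rfl⟩
    simp only [w, dif_pos h]
    exact (hu.exists_local_primitive h.choose_spec.1).choose_spec x h.choose_spec.2.symm
  have hnear : ∀ x y : Tetrahedra n, NearVertex x.2 → T.toSpace y = T.toSpace x →
      NearVertex y.2 := by
    intro x y hx hxy
    obtain ⟨p, hp⟩ := Gluing.exists_perm_of_toSpace_eq hxy.symm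
    exact hp ▸ nearVertex_permSimplex hx p
  have hopen : ∀ x : Tetrahedra n, NearVertex x.2 → ∀ᶠ y : Tetrahedra n in 𝓝 x,
      NearVertex y.2 := by
    rintro x ⟨a, ha, ha'⟩
    have hc : Continuous fun y : Tetrahedra n => y.2.1 a :=
      (continuous_apply a).comp (continuous_subtype_val.comp continuous_snd)
    filter_upwards [hc.continuousAt.eventually (lt_mem_nhds ha),
      hc.continuousAt.eventually (gt_mem_nhds ha')] with y hy hy'
    exact ⟨a, hy, hy'⟩
  refine ⟨w, hw, ?_⟩
  rintro _ ⟨x₀, hx₀, rfl⟩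
  refine nhdsWithin_le_nhds ?_
  -- The quotient map is closed, since its source is compact and its target Hausdorff; so a property
  -- holding near each point of a fibre holds on all fibres nearby.
  have h1 := T.isClosedMap_toSpace.eventually_nhds_fiber
    (p := fun y => NearVertex y.2 ∧ ∀ᶠ z in 𝓝 y, w (T.toSpace x₀) (T.toSpace z) =
      w (T.toSpace x₀) (T.toSpace y) + (linkInterp u z - linkInterp u y)) (T.toSpace x₀)
    (fun x hx => by
      have hx' := hnear _ _ hx₀ hx
      have h1 := hw x hx'
      rw [show T.toSpace x = T.toSpace x₀ from hx] at h1
      filter_upwards [hopen x hx', h1, eventually_eventually_nhds.2 h1] with y hy hy1 hy2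
      refine ⟨hy, hy2.mono fun z hz => ?_⟩
      rw [hz, hy1]
      ring)
  refine h1.mono fun Q hQ => nhdsWithin_le_nhds ?_
  have h2 := T.isClosedMap_toSpace.eventually_nhds_fiber
    (p := fun z => w (T.toSpace x₀) (T.toSpace z) =
      w (T.toSpace x₀) Q + w Q (T.toSpace z)) Q
    (fun y hy => by
      obtain ⟨hy1, hy2⟩ := hQ y hy
      obtain rfl : T.toSpace y = Q := hy
      filter_upwards [hy2, hw y hy1] with z hz hz'
      rw [hz, hz'])
  filter_upwards [h2] with Z hZ
  obtain ⟨z, rfl⟩ := T.toSpace_surjective Z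
  exact hZ z rfl

end NormalSurface

namespace NormalSurface

variable {n : ℕ} {T : Gluing n} {u c : Fin n → Fin 4 → Fin 4 → ℝ}

/-- A vertex of the simplex. -/
def simplexVertex (a : Fin 4) : stdSimplex ℝ (Fin 4) := ⟨Pi.single a 1, single_mem_stdSimplex ℝ a⟩

theorem eq_simplexVertex {x : stdSimplex ℝ (Fin 4)} {a : Fin 4} (h : x.1 a = 1) :
    x = simplexVertex a := by
  refine Subtype.ext (funext fun b => ?_)
  by_cases hb : b = a
  · subst hb
    simp [simplexVertex, h]
  · have := add_le_one (x := x) hb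
    have := x.2.1 b
    simp only [simplexVertex, Pi.single_eq_of_ne hb]
    linarith

theorem permSimplex_simplexVertex (p : Equiv.Perm (Fin 4)) (a : Fin 4) :
    permSimplex p (simplexVertex a) = simplexVertex (p a) :=
  eq_simplexVertex (by simp [permSimplex, simplexVertex])

theorem not_nearVertex_simplexVertex (a : Fin 4) : ¬ NearVertex (simplexVertex a) := fun h => by
  have := h.lt_one a
  simp [simplexVertex] at this

theorem toSpace_ne_of_nearVertex {x y : Tetrahedra n} (hx : NearVertex x.2) {a : Fin 4}
    (hy : y.2 = simplexVertex a) : T.toSpace x ≠ T.toSpace y := fun h => by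
  obtain ⟨p, hp⟩ := Gluing.exists_perm_of_toSpace_eq h
  have := nearVertex_permSimplex hx p
  rw [← hp, hy] at this
  exact not_nearVertex_simplexVertex a this

/-- The points near a vertex of the triangulation, including the vertex, form a neighbourhood. -/
theorem nearVertex_mem_nhds [T2Space T.Space] (i : Fin n) (a : Fin 4) :
    {P | P = T.toSpace (i, simplexVertex a) ∨
      ∃ x : Tetrahedra n, NearVertex x.2 ∧ T.toSpace x = P} ∈ 𝓝 (T.toSpace (i, simplexVertex a)) := by
  have h1 := T.isClosedMap_toSpace.eventually_nhds_fiber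
    (p := fun y => T.toSpace y = T.toSpace (i, simplexVertex a) ∨ NearVertex y.2)
    (T.toSpace (i, simplexVertex a)) (fun x hx => by
      obtain ⟨p, hp⟩ := Gluing.exists_perm_of_toSpace_eq (show _ = T.toSpace x from hx.symm)
      rw [permSimplex_simplexVertex] at hp
      have hc : Continuous fun y : Tetrahedra n => y.2.1 (p a) :=
        (continuous_apply (p a)).comp (continuous_subtype_val.comp continuous_snd)
      have hx1 : x.2.1 (p a) = 1 := by rw [hp]; simp [simplexVertex]
      have h1 : ∀ᶠ y : Tetrahedra n in 𝓝 x, y.1 = x.1 :=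
        continuous_fst.continuousAt.eventually ((isOpen_discrete {x.1}).mem_nhds rfl)
      filter_upwards [hc.continuousAt.eventually (lt_mem_nhds
        (show (1 / 2 : ℝ) < x.2.1 (p a) by rw [hx1]; norm_num)), h1] with y hy hy1
      rcases eq_or_ne (y.2.1 (p a)) 1 with h | h
      · left
        have : y = x := Prod.ext hy1 (by rw [hp, eq_simplexVertex h])
        rw [this]
        exact hx
      · exact Or.inr ⟨p a, hy, lt_of_le_of_ne
          (y.2.2.2 ▸ Finset.single_le_sum (fun b _ => y.2.2.1 b) (Finset.mem_univ _)) h⟩)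
  filter_upwards [h1] with Q hQ
  obtain ⟨y, rfl⟩ := T.toSpace_surjective Q
  exact (hQ y rfl).imp id fun h => ⟨y, h, rfl⟩

theorem isPreconnected_corner (a : Fin 4) (ε : ℝ) :
    IsPreconnected {x : stdSimplex ℝ (Fin 4) | 1 - ε < x.1 a ∧ x.1 a < 1} := by
  rw [← IsInducing.subtypeVal.isPreconnected_image]
  have h : Convex ℝ (stdSimplex ℝ (Fin 4) ∩ ({x | 1 - ε < x a} ∩ {x | x a < 1})) := by
    have hl : IsLinearMap ℝ fun x : Fin 4 → ℝ => x a := (LinearMap.proj a).isLinear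
    exact (convex_stdSimplex ℝ _).inter
      ((convex_halfSpace_gt hl _).inter (convex_halfSpace_lt hl _))
  convert h.isPreconnected using 1
  ext x
  constructor
  · rintro ⟨x, hx, rfl⟩
    exact ⟨x.2, hx⟩
  · rintro ⟨hx, hx'⟩
    exact ⟨⟨x, hx⟩, hx', rfl⟩

/-- In a three-manifold triangulation, a cocycle on the vertex links that has a potential at the
corners of the links is a coboundary. -/
theorem IsCornerPotential.exists_potential [T2Space T.Space]
    [ChartedSpace (EuclideanHalfSpace 3) T.Space] (hu : IsCornerPotential T u c) :
    ∃ t : Fin n → Fin 4 → ℝ, ∀ i f j p, T.glue i f = some (j, p) → ∀ a, a ≠ f →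
      t j (p a) = t i a + c i f a := by
  classical
  obtain ⟨w, hw, hwc⟩ := hu.exists_germCocycle
  -- The primitive is chosen for the point `P` of the quotient, so all corners of tetrahedra
  -- identified at `P` share it.
  have hV : ∀ P : T.Space, ∃ f : T.Space → ℝ, ∀ i a, T.toSpace (i, simplexVertex a) = P →
      ∃ V, IsOpen V ∧ P ∈ V ∧ IsPrimitiveOn w f (V \ {P}) := by
    intro P
    by_cases h : ∃ i a, T.toSpace (i, simplexVertex a) = P
    · obtain ⟨i, a, rfl⟩ := h
      obtain ⟨V, hVo, hPV, -, f, hf⟩ := exists_primitiveOn_punctured_nhds (nearVertex_mem_nhds i a)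
        (hwc.mono (by
          rintro Q ⟨hQ | hQ, hQ'⟩
          · exact absurd hQ hQ'
          · exact hQ))
      exact ⟨f, fun _ _ _ => ⟨V, hVo, hPV, hf⟩⟩
    · exact ⟨0, fun i a hia => absurd ⟨i, a, hia⟩ h⟩
  choose f hf using hV
  -- On one punctured corner, `f` and `linkInterp` are both primitives of the same cocycle, and the
  -- corner is connected.
  have hκ : ∀ i a, ∃ κ, ∃ ε : ℝ, 0 < ε ∧ ∀ x : stdSimplex ℝ (Fin 4), 1 - ε < x.1 a → x.1 a < 1 →
      f (T.toSpace (i, simplexVertex a)) (T.toSpace (i, x)) - linkInterp u (i, x) = κ := by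
    intro i a
    obtain ⟨V, hVo, hPV, hfV⟩ := hf _ i a rfl
    have hcont : Continuous fun x : stdSimplex ℝ (Fin 4) => T.toSpace (i, x) :=
      T.continuous_toSpace.comp (Continuous.prodMk_right i)
    obtain ⟨ε', hε', hball⟩ := Metric.isOpen_iff.1 (hVo.preimage hcont) (simplexVertex a) hPV
    have hmem : ∀ x : stdSimplex ℝ (Fin 4), 1 - min (1 / 2) ε' < x.1 a → T.toSpace (i, x) ∈ V := by
      intro x hx
      refine hball ?_
      rw [Metric.mem_ball, Subtype.dist_eq, dist_pi_lt_iff hε']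
      have h1 : 1 - x.1 a < ε' := by linarith [min_le_right (1 / 2) ε']
      have h2 : x.1 a ≤ 1 :=
        x.2.2 ▸ Finset.single_le_sum (fun b _ => x.2.1 b) (Finset.mem_univ _)
      intro b
      rw [Real.dist_eq, abs_lt]
      by_cases hb : b = a
      · subst hb
        simp only [simplexVertex, Pi.single_eq_same]
        constructor <;> linarith
      · simp only [simplexVertex, Pi.single_eq_of_ne hb]
        have := add_le_one (x := x) hb
        have := x.2.1 b
        constructor <;> linarith
    have hconst {x y} := (isPreconnected_corner a (min (1 / 2) ε')).apply_eq_of_eventually_eq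
      (f := fun x => f (T.toSpace (i, simplexVertex a)) (T.toSpace (i, x)) - linkInterp u (i, x))
      (fun x hx => nhdsWithin_le_nhds (by
        have hx' : NearVertex x := ⟨a, by linarith [hx.1, min_le_left (1 / 2) ε'], hx.2⟩
        have hne : T.toSpace (i, x) ∈ V \ {T.toSpace (i, simplexVertex a)} :=
          ⟨hmem x hx.1, toSpace_ne_of_nearVertex hx' rfl⟩
        have h1 := hfV _ hne
        rw [(hVo.sdiff isClosed_singleton).nhdsWithin_eq hne] at h1
        filter_upwards [hcont.continuousAt.eventually h1,
          (Continuous.prodMk_right i).continuousAt.eventually (hw (i, x) hx')] with y hy hy'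
        rw [hy, hy']
        ring)) (x := x) (y := y)
    by_cases hne : ∃ x : stdSimplex ℝ (Fin 4), 1 - min (1 / 2) ε' < x.1 a ∧ x.1 a < 1
    · obtain ⟨x₀, hx₀⟩ := hne
      exact ⟨_, _, lt_min (by norm_num) hε', fun x hx hx' => hconst ⟨hx, hx'⟩ hx₀⟩
    · exact ⟨0, _, lt_min (by norm_num) hε', fun x hx hx' => absurd ⟨x, hx, hx'⟩ hne⟩
  choose κ ε hε hκ using hκ
  -- At a point of the edge from `a` to `b`, near `a`, both sides of the face see the same value of
  -- `f`; hence `κ` changes by minus the jump of `linkInterp`, which is `c i g a`.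
  refine ⟨fun i a => - κ i a, fun i g j p hp a hag => ?_⟩
  obtain ⟨b, hba, hbg⟩ : ∃ b : Fin 4, b ≠ a ∧ b ≠ g :=
    (by decide : ∀ a g : Fin 4, ∃ b, b ≠ a ∧ b ≠ g) a g
  let δ := min (1 / 2) (min (ε i a) (ε j (p a))) / 2
  have hδ : 0 < δ := by
    have : 0 < min (1 / 2) (min (ε i a) (ε j (p a))) :=
      lt_min (by norm_num) (lt_min (hε _ _) (hε _ _))
    positivity
  have hδ1 : δ < 1 / 2 := by
    have := min_le_left (1 / 2) (min (ε i a) (ε j (p a)))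
    simp only [δ] at *
    linarith
  have hδ2 : δ < ε i a := by
    have := min_le_right (1 / 2) (min (ε i a) (ε j (p a)))
    have := min_le_left (ε i a) (ε j (p a))
    simp only [δ] at *
    linarith
  have hδ3 : δ < ε j (p a) := by
    have := min_le_right (1 / 2) (min (ε i a) (ε j (p a)))
    have := min_le_right (ε i a) (ε j (p a))
    simp only [δ] at *
    linarith
  let x : stdSimplex ℝ (Fin 4) := ⟨(1 - δ) • Pi.single a 1 + δ • Pi.single b 1,
    convex_stdSimplex ℝ _ (single_mem_stdSimplex ℝ a) (single_mem_stdSimplex ℝ b)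
      (by linarith) hδ.le (by ring)⟩
  have hxa : x.1 a = 1 - δ := by simp [x, hba]
  have hxg : x.1 g = 0 := by simp [x, hag.symm, hbg.symm]
  have hxn : NearVertex x := ⟨a, by linarith, by linarith⟩
  have hpx : (permSimplex p x).1 (p a) = 1 - δ := by simp [permSimplex, hxa]
  have e1 := hκ i a x (by linarith) (by linarith)
  have e2 := hκ j (p a) (permSimplex p x) (by linarith) (by linarith)
  have hv : (simplexVertex a).1 g = 0 := by simp [simplexVertex, hag.symm]
  rw [← Gluing.toSpace_eq_of_ident (Gluing.ident_permSimplex hp hxg),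
    ← permSimplex_simplexVertex,
    ← Gluing.toSpace_eq_of_ident (Gluing.ident_permSimplex hp hv)] at e2
  have e3 := linkInterp_sub (u := u) (c := c i g) (hu _ _ _ _ hp) hxg
    (y := permSimplex p x) (fun a => by simp [permSimplex]) hxn.lt_one
  have e4 : (∑ b, if 1 / 2 < x.1 b then c i g b else 0) = c i g a := by
    rw [Finset.sum_eq_single a, if_pos (by linarith)]
    · intro b _ hb
      rw [if_neg]
      linarith [add_le_one (x := x) hb]
    · simp
  rw [e4] at e3
  linarith

/-- Every solution of the quadrilateral matching equations is the projection of a solution of the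
standard matching equations. -/
theorem Triangulation.exists_quadProj_eq (T : Triangulation n) {q : QuadVec n}
    (hq : QuadMatching T.toGluing q) (h0 : ∀ d, 0 ≤ q d) :
    ∃ v : StdVec n, (∀ d, 0 ≤ v d) ∧ StdMatching T.toGluing v ∧ quadProj v = q := by
  obtain ⟨hc, h2, -, ⟨hch⟩⟩ := T.manifold
  obtain ⟨u, hu⟩ := hq.exists_corner_potential
  have hu' : IsCornerPotential T.toGluing u (fun i f a => match T.glue i f with
      | some (j, p) => q (i, quadSep a f) - q (j, quadSep (p a) (p f))
      | none => 0) := by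
    intro i f j p hp a b hab haf hbf
    simp only [hp]
    exact hu i f j p hp a b hab haf hbf
  obtain ⟨t, ht⟩ := hu'.exists_potential
  -- The matching equations are unaffected by adding a constant to all triangle coordinates; `M` is
  -- large enough to make them non-negative.
  obtain ⟨M, hM⟩ := (Set.finite_range fun x : Fin n × Fin 4 => - t x.1 x.2).bddAbove
  refine ⟨fun d => Sum.elim (fun a => t d.1 a + M) (fun k => q (d.1, k)) d.2, ?_, ?_, rfl⟩
  · rintro ⟨i, a | k⟩
    · have := hM ⟨(i, a), rfl⟩
      simp only [Sum.elim_inl] at this ⊢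
      linarith
    · exact h0 _
  · intro i f j p hp a haf
    have := ht i f j p hp a haf
    simp only [hp] at this
    simp only [Sum.elim_inl, Sum.elim_inr]
    linarith

end NormalSurface

/-! ### Vertices of slices of the simplex. -/

/-- The points with non-negative coordinates of sum `1` in a subspace. -/
def simplexSlice {ι : Type} [Fintype ι] (M : Submodule ℝ (ι → ℝ)) : Set (ι → ℝ) :=
  {x | (∀ c, 0 ≤ x c) ∧ ∑ c, x c = 1 ∧ x ∈ M}

section Slice

variable {ι : Type} [Fintype ι] {M : Submodule ℝ (ι → ℝ)}

theorem normalize_mem_simplexSlice {y : ι → ℝ} (h0 : ∀ c, 0 ≤ y c) (hs : 0 < ∑ c, y c)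
    (hy : y ∈ M) : (∑ c, y c)⁻¹ • y ∈ simplexSlice M :=
  ⟨fun c => mul_nonneg (inv_nonneg.2 hs.le) (h0 c), by
    simp only [Pi.smul_apply, smul_eq_mul, ← Finset.mul_sum]
    exact inv_mul_cancel₀ hs.ne', M.smul_mem _ hy⟩

/-- A vertex has minimal support. -/
theorem eq_smul_of_mem_extremePoints {x y : ι → ℝ} (hx : x ∈ (simplexSlice M).extremePoints ℝ)
    (h0 : ∀ c, 0 ≤ y c) (hy : y ∈ M) (hxy : NormalSurface.Dominates x y) :
    y = (∑ c, y c) • x := by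
  have hnn : 0 ≤ ∑ c, y c := Finset.sum_nonneg fun c _ => h0 c
  rcases hnn.eq_or_lt with hs | hs
  · rw [← hs, zero_smul]
    ext c
    exact (Finset.sum_eq_zero_iff_of_nonneg fun c _ => h0 c).1 hs.symm c (Finset.mem_univ c)
  · have hz := normalize_mem_simplexSlice h0 hs hy
    set z := (∑ c, y c)⁻¹ • y with hzdef
    suffices z = x by rw [← this, hzdef, smul_inv_smul₀ hs.ne']
    -- Domination allows a small multiple of `z` to be subtracted from `x`; then `x` lies inside a
    -- segment starting at `z`, so extremality forces `z = x`.
    obtain ⟨ε, hε0, hε1, hε⟩ : ∃ ε : ℝ, 0 < ε ∧ ε < 1 ∧ ∀ c, ε * z c ≤ x c := by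
      have h1 : ∀ᶠ ε : ℝ in 𝓝[>] 0, 0 < ε := self_mem_nhdsWithin
      have h2 : ∀ᶠ ε : ℝ in 𝓝[>] 0, ε < 1 := nhdsWithin_le_nhds (gt_mem_nhds one_pos)
      have h3 : ∀ᶠ ε : ℝ in 𝓝[>] 0, ∀ c, ε * z c ≤ x c := by
        refine eventually_all.2 fun c => ?_
        rcases (hx.1.1 c).eq_or_lt with h | h
        · refine Eventually.of_forall fun ε => ?_
          simp [hzdef, hxy c h.symm, ← h]
        · have hc : Tendsto (fun ε : ℝ => ε * z c) (𝓝[>] 0) (𝓝 (0 * z c)) :=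
            ((continuous_id.mul continuous_const).tendsto 0).mono_left nhdsWithin_le_nhds
          rw [zero_mul] at hc
          exact (hc.eventually (gt_mem_nhds h)).mono fun _ h => h.le
      obtain ⟨ε, h1, h2, h3⟩ := (h1.and (h2.and h3)).exists
      exact ⟨ε, h1, h2, h3⟩
    have h1ε : 0 < 1 - ε := by linarith
    have hz' : (1 - ε)⁻¹ • (x - ε • z) ∈ simplexSlice M := by
      refine ⟨fun c => mul_nonneg (inv_nonneg.2 h1ε.le) (by simpa using hε c), ?_,
        M.smul_mem _ (M.sub_mem hx.1.2.2 (M.smul_mem _ hz.2.2))⟩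
      simp only [Pi.smul_apply, Pi.sub_apply, smul_eq_mul, ← Finset.mul_sum,
        Finset.sum_sub_distrib, hx.1.2.1, hz.2.1, mul_one]
      exact inv_mul_cancel₀ h1ε.ne'
    refine hx.2 hz hz' ⟨ε, 1 - ε, hε0, h1ε, by ring, ?_⟩
    rw [smul_inv_smul₀ h1ε.ne']
    abel

theorem isCompact_simplexSlice : IsCompact (simplexSlice M) := by
  have h : simplexSlice M = stdSimplex ℝ ι ∩ M := by
    ext x
    exact ⟨fun h => ⟨⟨h.1, h.2.1⟩, h.2.2⟩, fun h => ⟨h.1.1, h.1.2, h.2⟩⟩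
  rw [h]
  exact (isCompact_stdSimplex ℝ ι).inter_right M.closed_of_finiteDimensional

/-- In a face where a sum of coordinates is not identically zero, this sum is not zero at some
vertex. -/
theorem exists_mem_extremePoints_simplexSlice (Z : Set ι) (D : Finset ι) {y : ι → ℝ}
    (hy : y ∈ simplexSlice M) (hyZ : ∀ c ∈ Z, y c = 0) (hyD : 0 < ∑ c ∈ D, y c) :
    ∃ x ∈ (simplexSlice M).extremePoints ℝ, (∀ c ∈ Z, x c = 0) ∧ 0 < ∑ c ∈ D, x c := by
  let l : (ι → ℝ) → ℝ := fun x => ∑ c ∈ D, x c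
  have hl : Continuous l := by fun_prop
  have hlin : ∀ (a b : ℝ) x y, l (a • x + b • y) = a * l x + b * l y := fun a b x y => by
    simp [l, Finset.sum_add_distrib, Finset.mul_sum]
  let K := simplexSlice M ∩ {x | ∀ c ∈ Z, x c = 0}
  have hK : IsCompact K := isCompact_simplexSlice.inter_right (by
    simp only [ofPred_forall]
    exact isClosed_biInter fun c _ => isClosed_eq (continuous_apply c) continuous_const)
  -- The points of `K` where `l` is maximal form a face, and an extreme point of this face is
  -- extreme in the whole slice.
  obtain ⟨m, hm, hmax⟩ := hK.exists_isMaxOn ⟨y, hy, hyZ⟩ hl.continuousOn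
  have hmpos : 0 < l m := hyD.trans_le (hmax ⟨hy, hyZ⟩)
  have hK' : IsCompact (K ∩ {x | l x = l m}) :=
    hK.inter_right (isClosed_eq hl continuous_const)
  obtain ⟨x, hx, hxe⟩ := hK'.extremePoints_nonempty ⟨m, hm, rfl⟩
  refine ⟨x, ⟨hx.1.1, ?_⟩, hx.1.2, hmpos.trans_eq hx.2.symm⟩
  rintro x₁ h₁ x₂ h₂ ⟨a, b, ha, hb, hab, rfl⟩
  have hz : ∀ c ∈ Z, x₁ c = 0 ∧ x₂ c = 0 := by
    intro c hc
    have h := hx.1.2 c hc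
    simp only [Pi.add_apply, Pi.smul_apply, smul_eq_mul] at h
    have := mul_nonneg ha.le (h₁.1 c)
    have := mul_nonneg hb.le (h₂.1 c)
    exact ⟨(mul_eq_zero_iff_left ha.ne').1 (by linarith),
      (mul_eq_zero_iff_left hb.ne').1 (by linarith)⟩
  have hK₁ : x₁ ∈ K := ⟨h₁, fun c hc => (hz c hc).1⟩
  have hK₂ : x₂ ∈ K := ⟨h₂, fun c hc => (hz c hc).2⟩
  have e1 : l x₁ ≤ l m := hmax hK₁
  have e2 : l x₂ ≤ l m := hmax hK₂
  have e3 : a * l x₁ + b * l x₂ = l m := by rw [← hlin]; exact hx.2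
  obtain rfl : b = 1 - a := by linarith
  refine hxe ⟨hK₁, ?_⟩ ⟨hK₂, ?_⟩ ⟨a, 1 - a, ha, hb, hab, rfl⟩
  · refine le_antisymm e1 ?_
    nlinarith
  · refine le_antisymm e2 ?_
    nlinarith

end Slice

/-! ### Standard and quadrilateral vertices. -/

namespace NormalSurface

variable {n : ℕ} {T : Gluing n}

/-- The solutions of the standard matching equations. -/
def stdSubmodule (T : Gluing n) : Submodule ℝ (StdVec n) where
  carrier := {v | StdMatching T v}
  add_mem' := fun {v w} hv hw i f j p hp a ha => by
    have := hv i f j p hp a ha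
    have := hw i f j p hp a ha
    simp only [Pi.add_apply]
    linarith
  zero_mem' := fun i f j p _ a _ => by simp
  smul_mem' := fun r v hv i f j p hp a ha => by
    have := hv i f j p hp a ha
    simp only [Pi.smul_apply, smul_eq_mul, ← mul_add, this]

/-- The solutions of the quadrilateral matching equations. -/
def quadSubmodule (T : Gluing n) : Submodule ℝ (QuadVec n) where
  carrier := {q | QuadMatching T q}
  add_mem' := fun {v w} hv hw m x hx => by
    simp only [Pi.add_apply, Finset.sum_add_distrib, hv m x hx, hw m x hx]
  zero_mem' := fun m x _ => by simp
  smul_mem' := fun r v hv m x hx => by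
    simp only [Pi.smul_apply, smul_eq_mul, ← Finset.mul_sum, hv m x hx]

/-- The projection of a standard solution is a quadrilateral solution. -/
theorem StdMatching.quadMatching {v : StdVec n} (hv : StdMatching T v) :
    QuadMatching T (quadProj v) := by
  rintro m x ⟨hm, hx, hmx, -⟩
  let t : ℕ → ℝ := fun r => v ((x r).1, Sum.inl ((x r).2 0))
  have h : ∀ r < m, t r + quadProj v (downward (x r)) =
      t (r + 1) + quadProj v (upward (x (r + 1))) := by
    intro r hr
    have h1 := hx r hr
    simp only [Gluing.next, Option.map_eq_some_iff, Prod.exists] at h1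
    obtain ⟨j, p, hp, h1⟩ := h1
    have h2 := hv _ _ _ _ hp ((x r).2 0) (by simp)
    simp only [t, ← h1, quadProj, upward, downward, Equiv.Perm.coe_mul, Function.comp_apply,
      Equiv.swap_apply_left, Equiv.swap_apply_of_ne_of_ne (show (0 : Fin 4) ≠ 2 by decide)
      (show (0 : Fin 4) ≠ 3 by decide)]
    exact h2
  have h3 := Finset.sum_congr rfl fun r hr => h r (Finset.mem_range.1 hr)
  rw [Finset.sum_add_distrib, Finset.sum_add_distrib] at h3
  have h4 := Finset.sum_range_succ t m
  rw [Finset.sum_range_succ', show t m = t 0 by simp only [t, hmx]] at h4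
  have h5 := Finset.sum_range_succ (fun r => quadProj v (upward (x r))) m
  rw [Finset.sum_range_succ', hmx] at h5
  linarith

theorem sum_stdCoord (v : StdVec n) :
    ∑ c, v c = ∑ x : Fin n × Fin 4, v (x.1, Sum.inl x.2) + ∑ c, quadProj v c := by
  simp only [Fintype.sum_prod_type, Fintype.sum_sum_type, Finset.sum_add_distrib, quadProj]

/-- The quadrilateral coordinates among all coordinates. -/
def quadCoords (n : ℕ) : Finset (StdCoord n) :=
  Finset.univ.map ⟨fun c : QuadCoord n => (c.1, Sum.inr c.2), fun c d h => by
    simpa [Prod.ext_iff] using h⟩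

theorem sum_quadCoords (v : StdVec n) : ∑ c ∈ quadCoords n, v c = ∑ c, quadProj v c := by
  rw [quadCoords, Finset.sum_map]
  rfl

theorem mem_quadCoords {c : StdCoord n} :
    c ∈ quadCoords n ↔ ∃ d : QuadCoord n, (d.1, Sum.inr d.2) = c := by
  rw [quadCoords, Finset.mem_map]
  exact ⟨fun ⟨d, _, h⟩ => ⟨d, h⟩, fun ⟨d, h⟩ => ⟨d, Finset.mem_univ _, h⟩⟩

theorem QuadConstraints.of_dominates {q r : QuadVec n} (hq : QuadConstraints q)
    (h : Dominates q r) : QuadConstraints r := fun i k l hkl =>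
  (hq i k l hkl).imp (h _) (h _)

/-- Every vertex of the quadrilateral solution set comes from the standard solution set. -/
theorem Triangulation.exists_mem_stdSolutionSet (T : Triangulation n) {w : QuadVec n}
    (hw : w ∈ quadSolutionSet T.toGluing) :
    ∃ v ∈ stdSolutionSet T.toGluing, ∃ r : ℝ, 0 < r ∧ quadProj v = r • w := by
  obtain ⟨y, hy0, hy, rfl⟩ := T.exists_quadProj_eq hw.1.1.2.2 hw.1.1.1
  have hq : ∑ c, quadProj y c = 1 := hw.1.1.2.1
  have hs : 0 < ∑ c, y c := by
    rw [sum_stdCoord, hq]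
    have : 0 ≤ ∑ x : Fin n × Fin 4, y (x.1, Sum.inl x.2) := Finset.sum_nonneg fun c _ => hy0 _
    linarith
  -- In the face where the zero quadrilateral coordinates of the lift `y` stay zero, a vertex with
  -- some quadrilateral is chosen. Its projection is dominated by `w`, so it is a multiple of `w` by
  -- minimality of support.
  obtain ⟨v, hv, hvZ, hvD⟩ := exists_mem_extremePoints_simplexSlice
    (M := stdSubmodule T.toGluing) {c | y c = 0 ∧ c ∈ quadCoords n}
    (quadCoords n) (normalize_mem_simplexSlice hy0 hs hy)
    (fun c hc => by simp [hc.1]) (by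
      rw [sum_quadCoords]
      change 0 < ∑ c, (∑ c, y c)⁻¹ * quadProj y c
      rw [← Finset.mul_sum, hq, mul_one]
      exact inv_pos.2 hs)
  rw [sum_quadCoords] at hvD
  have hdom : Dominates (quadProj y) (quadProj v) := fun c hc =>
    hvZ _ ⟨hc, mem_quadCoords.2 ⟨c, rfl⟩⟩
  refine ⟨v, ⟨hv, hw.2.of_dominates hdom⟩, _, hvD, ?_⟩
  exact eq_smul_of_mem_extremePoints (M := quadSubmodule T.toGluing) hw.1 (fun c => hv.1.1 _)
    (StdMatching.quadMatching hv.1.2.2) hdom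

/-- With equal quadrilateral parts, the difference `D` of the triangle coordinates is constant
across faces, so the indicator of any of its level sets is a solution made of triangles only. At a
positive level `v` dominates this indicator and must be proportional to it, hence has no
quadrilaterals. -/
theorem mul_inl_le_of_mem_extremePoints {v v' : StdVec n}
    (hv : v ∈ (stdSolutionSpace T).extremePoints ℝ) (hv' : v' ∈ stdSolutionSpace T) {r r' : ℝ}
    (hr' : 0 ≤ r') (h : r • quadProj v = r' • quadProj v') (h0 : quadProj v ≠ 0) (i : Fin n)
    (a : Fin 4) : r * v (i, Sum.inl a) ≤ r' * v' (i, Sum.inl a) := by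
  classical
  let D : Fin n → Fin 4 → ℝ := fun i a => r * v (i, Sum.inl a) - r' * v' (i, Sum.inl a)
  have hD : ∀ i f j p, T.glue i f = some (j, p) → ∀ a, a ≠ f → D i a = D j (p a) := by
    intro i f j p hp a ha
    have h1 := hv.1.2.2 i f j p hp a ha
    have h2 := hv'.2.2 i f j p hp a ha
    have h3 := congr_fun h (i, quadSep a f)
    have h4 := congr_fun h (j, quadSep (p a) (p f))
    simp only [Pi.smul_apply, smul_eq_mul, quadProj] at h3 h4
    simp only [D]
    linear_combination r * h1 - r' * h2 - h3 + h4
  by_contra! hlt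
  have hd : 0 < D i a := by simp only [D]; linarith
  let y : StdVec n := fun c => Sum.elim (fun b => if D c.1 b = D i a then 1 else 0) (fun _ => 0) c.2
  have hy0 : ∀ c, 0 ≤ y c := by
    rintro ⟨j, b | k⟩
    · simp only [y, Sum.elim_inl]
      split_ifs <;> norm_num
    · simp [y]
  have hy : StdMatching T y := by
    intro i f j p hp a ha
    simp only [y, Sum.elim_inl, Sum.elim_inr, hD i f j p hp a ha]
  have hdom : Dominates v y := by
    rintro ⟨j, b | k⟩ hc
    · simp only [y, Sum.elim_inl]
      rw [if_neg]
      have := mul_nonneg hr' (hv'.1 (j, Sum.inl b))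
      have e : D j b = r * v (j, Sum.inl b) - r' * v' (j, Sum.inl b) := rfl
      rw [hc] at e
      linarith
    · rfl
  have hyv := eq_smul_of_mem_extremePoints (M := stdSubmodule T) hv hy0 hy hdom
  have hpos : ∑ c, y c ≠ 0 := by
    intro h
    rw [h, zero_smul] at hyv
    have := congr_fun hyv (i, Sum.inl a)
    simp [y] at this
  refine h0 (funext fun c => ?_)
  have := congr_fun hyv (c.1, Sum.inr c.2)
  simp only [y, Sum.elim_inr, Pi.smul_apply, smul_eq_mul] at this
  exact (mul_eq_zero.1 this.symm).resolve_left hpos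

/-- A vertex of the standard solution space whose projection is not zero is determined by the ray
of this projection. -/
theorem eq_of_smul_quadProj_eq {v v' : StdVec n} (hv : v ∈ (stdSolutionSpace T).extremePoints ℝ)
    (hv' : v' ∈ (stdSolutionSpace T).extremePoints ℝ) {r r' : ℝ} (hr : 0 < r) (hr' : 0 < r')
    (h : r • quadProj v = r' • quadProj v') (h0 : quadProj v ≠ 0) : v = v' := by
  have h0' : quadProj v' ≠ 0 := by
    intro h1
    rw [h1, smul_zero, smul_eq_zero] at h
    exact h.elim hr.ne' h0
  have key : ∀ c, r * v c = r' * v' c := by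
    rintro ⟨i, a | k⟩
    · exact le_antisymm (mul_inl_le_of_mem_extremePoints hv hv'.1 hr'.le h h0 i a)
        (mul_inl_le_of_mem_extremePoints hv' hv.1 hr.le h.symm h0' i a)
    · exact congr_fun h (i, k)
  have hs := Finset.sum_congr rfl fun c (_ : c ∈ Finset.univ) => key c
  rw [← Finset.mul_sum, ← Finset.mul_sum, hv.1.2.1, hv'.1.2.1, mul_one, mul_one] at hs
  subst hs
  exact funext fun c => mul_left_cancel₀ hr.ne' (key c)

/-- If there are tetrahedra, the standard solution set is not empty: it has vertices without
quadrilaterals. -/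
theorem stdSolutionSet_nonempty (T : Gluing n) (hn : 0 < n) : (stdSolutionSet T).Nonempty := by
  let y : StdVec n := fun c => Sum.elim (fun _ => 1) (fun _ => 0) c.2
  have hy0 : ∀ c, 0 ≤ y c := by rintro ⟨i, a | k⟩ <;> simp [y]
  have hy : StdMatching T y := fun i f j p _ a _ => by simp [y]
  have hs : 0 < ∑ c, y c :=
    Finset.sum_pos' (fun c _ => hy0 c) ⟨(⟨0, hn⟩, Sum.inl 0), Finset.mem_univ _, by simp [y]⟩
  have hz := normalize_mem_simplexSlice (M := stdSubmodule T) hy0 hs hy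
  obtain ⟨v, hv, hvZ, -⟩ := exists_mem_extremePoints_simplexSlice
    {c | c ∈ quadCoords n} Finset.univ hz (fun c hc => by
      obtain ⟨d, rfl⟩ := mem_quadCoords.1 hc
      simp [y]) (by rw [hz.2.1]; norm_num)
  refine ⟨v, hv, fun i k l _ => Or.inl (hvZ _ (mem_quadCoords.2 ⟨(i, k), rfl⟩))⟩

end NormalSurface

/-! ### Correctness of the selection by domination. -/

namespace NormalSurface

theorem Dominates.of_projImage_eq {ι : Type} [Fintype ι] {x y : ι → ℝ} (hy : ∑ c, y c ≠ 0)
    (h : projImage x = projImage y) : Dominates x y := fun c hc => by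
  have := congr_fun h c
  simp only [projImage, hc, zero_div] at this
  exact (div_eq_zero_iff.1 this.symm).resolve_right hy

theorem projImage_smul {ι : Type} [Fintype ι] {x : ι → ℝ} {r : ℝ} (hr : r ≠ 0) :
    projImage (r • x) = projImage x := by
  ext c
  simp only [projImage, Pi.smul_apply, smul_eq_mul, ← Finset.mul_sum]
  exact mul_div_mul_left _ _ hr

theorem projImage_eq_self {ι : Type} [Fintype ι] {x : ι → ℝ} (hx : ∑ c, x c = 1) :
    projImage x = x := by
  ext c
  simp [projImage, hx]

theorem mem_selection {n : ℕ} {q : List (QuadVec n)} {w : QuadVec n} :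
    w ∈ selection q ↔ ∃ i : Fin q.length,
      (∀ j, j ≠ i → ¬ Dominates (q.get i) (q.get j)) ∧ projImage (q.get i) = w := by
  simp [selection]

/-- Entries with the same projective image dominate each other, so neither would be selected. -/
theorem nodup_selection {n : ℕ} {q : List (QuadVec n)} (hq : ∀ x ∈ q, ∑ c, x c ≠ 0) :
    (selection q).Nodup := by
  classical
  refine List.Nodup.map_on ?_ ((List.nodup_finRange _).filter _)
  intro i hi j _ hij
  by_contra hne
  simp only [List.mem_filter, decide_eq_true_eq] at hi
  exact hi.2 j (Ne.symm hne) (Dominates.of_projImage_eq (hq _ (List.get_mem _ _)) hij)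

variable {n k : ℕ}

theorem sum_quadProj_pos {T : Gluing n} {v : StdVec n} (hv : v ∈ stdSolutionSpace T)
    (h0 : quadProj v ≠ 0) : 0 < ∑ c, quadProj v c := by
  refine lt_of_le_of_ne (Finset.sum_nonneg fun c _ => hv.1 _) fun h => h0 (funext fun c => ?_)
  exact (Finset.sum_eq_zero_iff_of_nonneg fun c _ => hv.1 _).1 h.symm c (Finset.mem_univ c)

theorem exists_mem_quadSolutionSet_dominated {T : Gluing n} {v : StdVec n}
    (hv : v ∈ stdSolutionSet T) (h0 : quadProj v ≠ 0) :
    ∃ w ∈ quadSolutionSet T, Dominates (quadProj v) w := by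
  have hs := sum_quadProj_pos hv.1.1 h0
  have hz := normalize_mem_simplexSlice (M := quadSubmodule T) (fun c => hv.1.1.1 _) hs
    (StdMatching.quadMatching hv.1.1.2.2)
  obtain ⟨w, hw, hwZ, -⟩ := exists_mem_extremePoints_simplexSlice
    {c | quadProj v c = 0} Finset.univ hz (fun c hc => by
      simp only [Pi.smul_apply, smul_eq_mul]
      exact mul_eq_zero_of_right _ hc) (by rw [hz.2.1]; norm_num)
  exact ⟨w, ⟨hw, hv.2.of_dominates hwZ⟩, hwZ⟩

/-- The list of the projections of vectors `V`, the vertices in the standard solution set whose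
projections are not zero. -/
theorem Triangulation.mem_selection_iff (T : Triangulation n) {V : List (StdVec n)} (hV : V.Nodup)
    (hmem : ∀ x, x ∈ V ↔ x ∈ stdSolutionSet T.toGluing ∧ quadProj x ≠ 0) {w : QuadVec n} :
    w ∈ selection (V.map quadProj) ↔ w ∈ quadSolutionSet T.toGluing := by
  have hget : ∀ i : Fin (V.map quadProj).length, ∃ x ∈ V, (V.map quadProj).get i = quadProj x :=
    fun i => by
      obtain ⟨x, hx, h⟩ := List.mem_map.1 (List.get_mem (V.map quadProj) i)
      exact ⟨x, hx, h.symm⟩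
  have hpos : ∀ x ∈ V, ∃ i : Fin (V.map quadProj).length, (V.map quadProj).get i = quadProj x ∧
      V[i.1]'(by simpa using i.2) = x := fun x hx => by
    obtain ⟨i, hi, rfl⟩ := List.getElem_of_mem hx
    exact ⟨⟨i, by simpa using hi⟩, by simp, rfl⟩
  rw [mem_selection]
  constructor
  · rintro ⟨i, hi, rfl⟩
    obtain ⟨x, hx, hxi⟩ := hget i
    obtain ⟨hxs, hx0⟩ := (hmem x).1 hx
    obtain ⟨w, hw, hdom⟩ := exists_mem_quadSolutionSet_dominated hxs hx0
    obtain ⟨y, hy, r, hr, hyw⟩ := T.exists_mem_stdSolutionSet hw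
    have hw0 : w ≠ 0 := by
      rintro rfl
      simpa using hw.1.1.2.1
    have hyV : y ∈ V := (hmem y).2 ⟨hy, by rw [hyw]; exact smul_ne_zero hr.ne' hw0⟩
    obtain ⟨j, hj, -⟩ := hpos y hyV
    -- The entry `i` dominates `w`, hence also the entry `j`, which is a multiple of `w`. Being
    -- selected, it can only be this entry itself.
    have hji : j = i := by
      by_contra hne
      refine hi j hne fun c hc => ?_
      rw [hxi] at hc
      rw [hj, hyw, Pi.smul_apply, hdom c hc, smul_zero]
    rw [← hji, hj, hyw, projImage_smul hr.ne', projImage_eq_self hw.1.1.2.1]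
    exact hw
  · intro hw
    have hw0 : w ≠ 0 := by
      rintro rfl
      simpa using hw.1.1.2.1
    obtain ⟨x, hx, r, hr, hxw⟩ := T.exists_mem_stdSolutionSet hw
    have hxV : x ∈ V := (hmem x).2 ⟨hx, by rw [hxw]; exact smul_ne_zero hr.ne' hw0⟩
    obtain ⟨i, hi, hiV⟩ := hpos x hxV
    refine ⟨i, fun j hji hdom => ?_, ?_⟩
    · have hj : (V.map quadProj).get j = quadProj (V[j.1]'(by simpa using j.2)) := by simp
      have hyV : V[j.1]'(by simpa using j.2) ∈ V := List.getElem_mem _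
      generalize hy : V[j.1]'(by simpa using j.2) = y at hj hyV
      obtain ⟨hys, hy0⟩ := (hmem y).1 hyV
      rw [hi, hj, hxw] at hdom
      have hyw := eq_smul_of_mem_extremePoints (M := quadSubmodule T.toGluing) (y := quadProj y) hw.1
        (fun c => hys.1.1.1 _) (StdMatching.quadMatching hys.1.1.2.2)
        (fun c hc => hdom c (by rw [Pi.smul_apply, hc, smul_zero]))
      have hs := sum_quadProj_pos hys.1.1 hy0
      -- A dominated entry lies on the ray of `w` too, so it comes from the same standard vertex; as
      -- `V` has no repetitions, it even has the same index.
      have hxy : y = x := eq_of_smul_quadProj_eq hys.1 hx.1 hr hs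
        (by rw [hxw, smul_smul, mul_comm, ← smul_smul, ← hyw]) hy0
      apply hji
      rw [← hiV] at hxy
      rw [← hy, hV.getElem_inj_iff] at hxy
      exact Fin.ext hxy
    · rw [hi, hxw, projImage_smul hr.ne', projImage_eq_self hw.1.1.2.1]

/-- The standard vectors behind the projections are kept, because it is their distinctness, not that
of the projections, that is known at first. -/
theorem projections_eq_map (v : Fin k → StdVec n) :
    ∃ V : List (StdVec n), projections v = V.map quadProj ∧ (Function.Injective v → V.Nodup) ∧
      ∀ x, x ∈ V ↔ x ∈ range v ∧ quadProj x ≠ 0 := by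
  classical
  refine ⟨(List.ofFn v).filter fun x => quadProj x ≠ 0, ?_, fun hv => ?_, fun x => ?_⟩
  · rw [projections, List.filter_map]
    congr
  · exact (List.nodup_ofFn.2 hv).filter _
  · simp [List.mem_ofFn]

/-- The conversion returns the quadrilateral solution set, without repetitions. -/
theorem Triangulation.stdToQuad_correct (T : Triangulation n) {v : Fin k → StdVec n}
    (hv : Function.Injective v) (hr : range v = stdSolutionSet T.toGluing) :
    (stdToQuad v).Nodup ∧ {w | w ∈ stdToQuad v} = quadSolutionSet T.toGluing := by
  obtain ⟨V, hV, hnodup, hmem⟩ := projections_eq_map v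
  rw [hr] at hmem
  rw [stdToQuad, hV]
  refine ⟨nodup_selection fun x hx => ?_, Set.ext fun w => T.mem_selection_iff (hnodup hv) hmem⟩
  obtain ⟨y, hy, rfl⟩ := List.mem_map.1 hx
  obtain ⟨hys, hy0⟩ := (hmem y).1 hy
  exact (sum_quadProj_pos hys.1.1 hy0).ne'

end NormalSurface

end

/-! ### Loop rule and the projection phase of the program. -/

namespace NormalSurface

section Loop

variable {N R A : Type} [DecidableEq N] [DecidableEq R] [DecidableEq A]

/-- Loop rule: an invariant, and a bound for the time of each round. -/
theorem run_loop {c : Cmd N R A} {x : N} {s : State N R A} (J : ℕ → State N R A → Prop) (K : ℕ)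
    (h0 : J 0 s.tick)
    (hs : ∀ r < s.nat x, ∀ s', J r s' →
      J (r + 1) (run c s'.tick) ∧ (run c s'.tick).time ≤ s'.time + K) :
    J (s.nat x) (run (.loop x c) s) ∧
      (run (.loop x c) s).time ≤ s.time + 1 + s.nat x * K := by
  have key : ∀ m ≤ s.nat x, J m ((fun s' => run c s'.tick)^[m] s.tick) ∧
      ((fun s' => run c s'.tick)^[m] s.tick).time ≤ s.time + 1 + m * K := by
    intro m
    induction m with
    | zero => exact fun _ => ⟨h0, by simp [State.tick]⟩
    | succ m ih =>
      intro hm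
      obtain ⟨h1, h2⟩ := ih (by omega)
      obtain ⟨h3, h4⟩ := hs m (by omega) _ h1
      rw [Function.iterate_succ_apply']
      refine ⟨h3, ?_⟩
      rw [add_mul, one_mul]
      omega
  exact key _ le_rfl

end Loop

/-- The states of the program. -/
abbrev PState : Type := State NReg RReg Arr

namespace Program

open Cmd NReg RReg Arr

/-- The first `e` entries of a vector `val` have been copied to the address `B`. -/
structure Copied (s₀ : PState) (val : ℕ → ℝ) (B e : ℕ) (s : PState) : Prop where
  input : s.arr input = s₀.arr input
  old : ∀ m < B, s.arr proj m = s₀.arr proj m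
  new : ∀ m < e, s.arr proj (B + m) = val m
  flag : s.nat flag = 0 ∧ (∀ m < e, val m = 0) ∨ s.nat flag = 1 ∧ ∃ m < e, val m ≠ 0
  dst : s.nat dst = B + e
  frame : ∀ x, x ≠ .flag → x ≠ .src → x ≠ .dst → s.nat x = s₀.nat x

/-- The body of the innermost loop of `project`. -/
def copyEntry : Cmd NReg RReg Arr :=
  load x input src ;; store proj dst x ;; ifZero x skip (const flag 1) ;; incr src ;; incr dst

theorem run_copyEntry {s₀ s : PState} {val : ℕ → ℝ} {B e : ℕ} (h : Copied s₀ val B e s)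
    (hv : s₀.arr input (s.nat src) = val e) :
    Copied s₀ val B (e + 1) (run copyEntry s) ∧
      (run copyEntry s).nat src = s.nat src + 1 ∧ (run copyEntry s).time = s.time + 6 := by
  have hx : s.arr input (s.nat src) = val e := by rw [h.input, hv]
  have hd := h.dst
  have harr : (run copyEntry s).arr =
      Function.update s.arr proj (Function.update (s.arr proj) (B + e) (val e)) := by
    by_cases h0 : val e = 0 <;>
      simp [copyEntry, run, State.setReal, State.setArr, State.setNat, State.tick, hx, h0, hd]
  have hflag : (run copyEntry s).nat flag = if val e = 0 then s.nat flag else 1 := by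
    by_cases h0 : val e = 0 <;>
      simp [copyEntry, run, State.setReal, State.setArr, State.setNat, State.tick, hx, h0]
  refine ⟨⟨?_, fun m hm => ?_, fun m hm => ?_, ?_, ?_, fun y h1 h2 h3 => ?_⟩, ?_, ?_⟩
  · simp [harr, h.input]
  · simp [harr, show m ≠ B + e by omega, h.old m hm]
  · rw [harr, Function.update_self, Function.update_apply]
    split_ifs with hme
    · rw [Nat.add_left_cancel hme]
    · exact h.new m (by omega)
  · rw [hflag]
    split_ifs with h0
    · rcases h.flag with ⟨h1, h2⟩ | ⟨h1, m, h2, h3⟩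
      · refine Or.inl ⟨h1, fun m hm => ?_⟩
        rcases Nat.lt_succ_iff_lt_or_eq.1 (Nat.lt_succ_iff.2 (Nat.le_of_lt_succ hm)) with hm | rfl
        exacts [h2 m hm, h0]
      · exact Or.inr ⟨h1, m, by omega, h3⟩
    · exact Or.inr ⟨rfl, e, by omega, h0⟩
  · by_cases h0 : val e = 0 <;>
      simp [copyEntry, run, State.setReal, State.setArr, State.setNat, State.tick, hx, h0, hd,
        add_assoc]
  · have := h.frame y h1 h2 h3
    by_cases h0 : val e = 0 <;>
      simp [copyEntry, run, State.setReal, State.setArr, State.setNat, State.tick, hx, h0, h1, h2,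
        h3, this]
  · by_cases h0 : val e = 0 <;>
      simp [copyEntry, run, State.setReal, State.setArr, State.setNat, State.tick, hx, h0]
  · by_cases h0 : val e = 0 <;>
      simp [copyEntry, run, State.setReal, State.setArr, State.setNat, State.tick, hx, h0]

theorem Copied.of_eq {s₀ s s' : PState} {val : ℕ → ℝ} {B e : ℕ} (h : Copied s₀ val B e s)
    (harr : s'.arr = s.arr) (hnat : ∀ x, x ≠ .src → s'.nat x = s.nat x) :
    Copied s₀ val B e s' := by
  refine ⟨by rw [harr, h.input], by rw [harr]; exact h.old, by rw [harr]; exact h.new, ?_, ?_,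
    fun x h1 h2 h3 => by rw [hnat x h2, h.frame x h1 h2 h3]⟩
  · rw [hnat _ (by decide)]
    exact h.flag
  · rw [hnat _ (by decide), h.dst]

/-- The body of the loop of `project` over the tetrahedra. -/
def copyTetrahedron : Cmd NReg RReg Arr :=
  incr src ;; incr src ;; incr src ;; incr src ;; loop three copyEntry

/-- The four increments skip the triangle coordinates. The bound is 4, plus 1 to start the loop,
plus 3 rounds of 7 steps. -/
theorem run_copyTetrahedron {s₀ s : PState} {val : ℕ → ℝ} {B e : ℕ} (h : Copied s₀ val B (3 * e) s)
    (hthree : s₀.nat three = 3)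
    (hv : ∀ m < 3, s₀.arr input (s.nat src + 4 + m) = val (3 * e + m)) :
    Copied s₀ val B (3 * (e + 1)) (run copyTetrahedron s) ∧
      (run copyTetrahedron s).nat src = s.nat src + 7 ∧
      (run copyTetrahedron s).time ≤ s.time + 26 := by
  set s₁ : PState := run (incr src ;; incr src ;; incr src ;; incr src) s with hs₁
  have h₁ : Copied s₀ val B (3 * e) s₁ := h.of_eq
    (by simp [hs₁, run, State.setNat, State.tick])
    (fun x hx => by simp [hs₁, run, State.setNat, State.tick, hx])
  have hsrc : s₁.nat src = s.nat src + 4 := by simp [hs₁, run, State.setNat, State.tick]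
  have htime : s₁.time = s.time + 4 := by simp [hs₁, run, State.setNat, State.tick]
  have hrun : run copyTetrahedron s = run (loop three copyEntry) s₁ := rfl
  have h3 : s₁.nat three = 3 := by
    rw [h₁.frame _ (by decide) (by decide) (by decide), hthree]
  have hl := run_loop (c := copyEntry) (x := three) (s := s₁)
    (fun r s' => Copied s₀ val B (3 * e + r) s' ∧ s'.nat src = s.nat src + 4 + r) 7
    ⟨h₁.of_eq rfl fun _ _ => rfl, hsrc⟩ (by
      rintro r hr s' ⟨h4, h5⟩
      rw [h3] at hr
      obtain ⟨h6, h7, h8⟩ := run_copyEntry (s := s'.tick) (h4.of_eq rfl fun _ _ => rfl)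
        (by rw [show s'.tick.nat src = s'.nat src from rfl, h5, hv r hr])
      refine ⟨⟨h6, ?_⟩, ?_⟩
      · rw [h7, show s'.tick.nat src = s'.nat src from rfl, h5, add_assoc]
      · rw [h8, show s'.tick.time = s'.time + 1 from rfl])
  rw [h3] at hl
  rw [hrun]
  obtain ⟨⟨h4, h5⟩, h6⟩ := hl
  exact ⟨h4, by rw [h5], by omega⟩

/-- Copy the quadrilateral coordinates of one vector. -/
def copyVector : Cmd NReg RReg Arr :=
  const flag 0 ;; copy dst base ;; loop dim copyTetrahedron

theorem run_copyVector {s : PState} {val : ℕ → ℝ} {n : ℕ} (hn : s.nat dim = n)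
    (hthree : s.nat three = 3)
    (hv : ∀ i < n, ∀ m < 3, s.arr input (s.nat src + 7 * i + 4 + m) = val (3 * i + m)) :
    Copied s val (s.nat base) (3 * n) (run copyVector s) ∧
      (run copyVector s).nat src = s.nat src + 7 * n ∧
      (run copyVector s).time ≤ s.time + 3 + n * 27 := by
  set s₁ : PState := run (const flag 0 ;; copy dst base) s with hs₁
  have h₁ : Copied s val (s.nat base) 0 s₁ := by
    refine ⟨?_, ?_, by simp, Or.inl ⟨?_, by simp⟩, ?_, fun x h1 h2 h3 => ?_⟩
    · simp [hs₁, run, State.setNat, State.tick]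
    · simp [hs₁, run, State.setNat, State.tick]
    · simp [hs₁, run, State.setNat, State.tick]
    · simp [hs₁, run, State.setNat, State.tick]
    · simp [hs₁, run, State.setNat, State.tick, h1, h3]
  have hsrc : s₁.nat src = s.nat src := by simp [hs₁, run, State.setNat, State.tick]
  have htime : s₁.time = s.time + 2 := by simp [hs₁, run, State.setNat, State.tick]
  have hrun : run copyVector s = run (loop dim copyTetrahedron) s₁ := rfl
  have hdim : s₁.nat dim = n := by
    rw [h₁.frame _ (by decide) (by decide) (by decide), hn]
  have hl := run_loop (c := copyTetrahedron) (x := dim) (s := s₁)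
    (fun r s' => Copied s val (s.nat base) (3 * r) s' ∧ s'.nat src = s.nat src + 7 * r) 27
    ⟨h₁.of_eq rfl fun _ _ => rfl, hsrc⟩ (by
      rintro r hr s' ⟨h4, h5⟩
      rw [hdim] at hr
      obtain ⟨h6, h7, h8⟩ := run_copyTetrahedron (s := s'.tick) (h4.of_eq rfl fun _ _ => rfl)
        hthree (by rw [show s'.tick.nat src = s'.nat src from rfl, h5]; exact hv r hr)
      refine ⟨⟨h6, ?_⟩, ?_⟩
      · rw [h7, show s'.tick.nat src = s'.nat src from rfl, h5]; ring
      · rw [show s'.tick.time = s'.time + 1 from rfl] at h8; omega)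
  rw [hdim] at hl
  rw [hrun]
  obtain ⟨⟨h4, h5⟩, h6⟩ := hl
  exact ⟨h4, h5, by omega⟩

/-- The array `a` holds the list `q`, one vector after another. -/
def HoldsList {n : ℕ} (a : ℕ → ℝ) (q : List (QuadVec n)) : Prop :=
  ∀ r (hr : r < q.length) (c : QuadCoord n), a (3 * n * r + quadPos c) = q[r] c

theorem quadPos_lt {n : ℕ} (c : QuadCoord n) : quadPos c < 3 * n := by
  have := c.1.2
  have := c.2.2
  simp only [quadPos]
  omega

theorem exists_quadPos_eq {n m : ℕ} (h : m < 3 * n) : ∃ c : QuadCoord n, quadPos c = m :=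
  ⟨(⟨m / 3, by omega⟩, ⟨m % 3, by omega⟩), by simp only [quadPos]; omega⟩

theorem HoldsList.append {n : ℕ} {a b : ℕ → ℝ} {q : List (QuadVec n)} {w : QuadVec n}
    (h : HoldsList a q) (hab : ∀ m < 3 * n * q.length, b m = a m)
    (hw : ∀ c, b (3 * n * q.length + quadPos c) = w c) : HoldsList b (q ++ [w]) := by
  intro r hr c
  rw [List.length_append, List.length_singleton] at hr
  rcases Nat.lt_succ_iff_lt_or_eq.1 hr with hr' | rfl
  · rw [List.getElem_append_left hr', ← h r hr' c, hab]
    have := quadPos_lt c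
    have : 3 * n * (r + 1) ≤ 3 * n * q.length := Nat.mul_le_mul_left _ hr'
    rw [mul_add] at this
    omega
  · rw [List.getElem_concat_length rfl, hw]

theorem run_project {n k : ℕ} {v : Fin k → StdVec n} {s : PState} (hs : HoldsInput v s) :
    HoldsList ((run project s).arr proj) (projections v) ∧
      (run project s).nat count = (projections v).length ∧ (run project s).nat dim = n ∧
      (run project s).nat one = 1 ∧
      (run project s).time ≤ s.time + 6 + k * (7 + n * 27) := by
  classical
  obtain ⟨hn, hk, hin⟩ := hs
  -- The invariant after `r` rounds: `proj` holds the non-zero projections among the first `r`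
  -- vectors. `base` stays put after a zero vector, which is therefore overwritten.
  let q : ℕ → List (QuadVec n) := fun r =>
    ((((List.ofFn v).take r).map quadProj).filter fun q => q ≠ 0)
  have hq : q k = projections v := by
    simp only [q, projections]
    rw [List.take_of_length_le (by simp)]
  have hqs : ∀ r (hr : r < k), q (r + 1) =
      if quadProj (v ⟨r, hr⟩) = 0 then q r else q r ++ [quadProj (v ⟨r, hr⟩)] := by
    intro r hr
    simp only [q]
    rw [List.take_succ_eq_append_getElem (by simpa using hr)]
    by_cases h : quadProj (v ⟨r, hr⟩) = 0 <;> simp [h]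
  set s₁ : PState := run (const one 1 ;; const three 3 ;; const src 0 ;; const base 0 ;;
    const count 0) s with hs₁
  have hrun : run project s = run (loop size (copyVector ;;
      ifEq flag one (incr count ;; copy base dst) skip)) s₁ := rfl
  have hsize : s₁.nat size = k := by simp [hs₁, run, State.setNat, State.tick, hk]
  have htime : s₁.time = s.time + 5 := by simp [hs₁, run, State.setNat, State.tick]
  have hl := run_loop (c := copyVector ;; ifEq flag one (incr count ;; copy base dst) skip)
    (x := size) (s := s₁)
    (fun r s' => s'.arr input = s.arr input ∧ HoldsList (s'.arr proj) (q r) ∧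
      s'.nat count = (q r).length ∧ s'.nat base = 3 * n * (q r).length ∧ s'.nat dim = n ∧
      s'.nat one = 1 ∧ s'.nat three = 3 ∧ s'.nat src = 7 * n * r) (7 + n * 27)
    (by
      refine ⟨?_, ?_, ?_, ?_, ?_, ?_, ?_, ?_⟩
      · simp [hs₁, run, State.setNat, State.tick]
      · simp [q, HoldsList]
      all_goals simp [hs₁, run, State.setNat, State.tick, q, hn])
    (by
      rintro r hr s' ⟨h1, h2, h3, h4, h5, h6, h7, h8⟩
      rw [hsize] at hr
      -- Quotient and remainder by 3 translate a packed quadrilateral position into the layout with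
      -- seven coordinates per tetrahedron.
      let val : ℕ → ℝ := fun m => s.arr input (7 * n * r + 7 * (m / 3) + 4 + m % 3)
      have hval : ∀ c : QuadCoord n, val (quadPos c) = quadProj (v ⟨r, hr⟩) c := by
        intro c
        rw [quadProj, ← hin ⟨r, hr⟩ (c.1, Sum.inr c.2)]
        simp only [val, stdPos, quadPos]
        congr 1
        have := c.2.2
        omega
      obtain ⟨h9, h10, h11⟩ := run_copyVector (s := s'.tick) (val := val) h5 h7 (by
        intro i hi m hm
        change s'.arr input (s'.nat src + 7 * i + 4 + m) = _
        rw [h1, h8]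
        simp only [val]
        congr 1
        omega)
      set s₂ := run copyVector s'.tick with hs₂
      change Copied s'.tick val (s'.nat base) (3 * n) s₂ at h9
      change s₂.nat src = s'.nat src + 7 * n at h10
      change s₂.time ≤ s'.time + 1 + 3 + n * 27 at h11
      have hrun₂ : run (copyVector ;; ifEq flag one (incr count ;; copy base dst) skip) s'.tick =
        run (ifEq flag one (incr count ;; copy base dst) skip) s₂ := rfl
      rw [hrun₂]
      have hdim : s₂.nat dim = n := (h9.frame _ (by decide) (by decide) (by decide)).trans h5
      have hone : s₂.nat one = 1 := (h9.frame _ (by decide) (by decide) (by decide)).trans h6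
      have hthree : s₂.nat three = 3 := (h9.frame _ (by decide) (by decide) (by decide)).trans h7
      have hcount : s₂.nat count = (q r).length :=
        (h9.frame _ (by decide) (by decide) (by decide)).trans h3
      have hbase : s₂.nat base = 3 * n * (q r).length :=
        (h9.frame _ (by decide) (by decide) (by decide)).trans h4
      have hdst : s₂.nat dst = 3 * n * (q r).length + 3 * n := by rw [h9.dst, h4]
      have hsrc : s₂.nat src = 7 * n * (r + 1) := by rw [h10, h8]; ring
      have hinp : s₂.arr input = s.arr input := h9.input.trans h1
      have hold : ∀ m < 3 * n * (q r).length, s₂.arr proj m = s'.arr proj m := by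
        rw [← h4]
        exact h9.old
      rcases h9.flag with ⟨h12, h13⟩ | ⟨h12, m, hm, h13⟩
      · have h0 : quadProj (v ⟨r, hr⟩) = 0 := funext fun c => by
          rw [← hval, h13 _ (quadPos_lt c)]; rfl
        have hqr : q (r + 1) = q r := by rw [hqs r hr, if_pos h0]
        have hst : run (ifEq flag one (incr count ;; copy base dst) skip) s₂ = s₂.tick.tick := by
          simp [run, h12, hone]
        rw [hst, hqr]
        refine ⟨⟨hinp, ?_, hcount, hbase, hdim, hone, hthree, hsrc⟩, ?_⟩
        · intro r' hr' c
          rw [← h2 r' hr' c]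
          refine hold _ ?_
          have := quadPos_lt c
          have : 3 * n * (r' + 1) ≤ 3 * n * (q r).length := Nat.mul_le_mul_left _ hr'
          rw [mul_add] at this
          omega
        · simp only [State.tick]
          omega
      · have h0 : quadProj (v ⟨r, hr⟩) ≠ 0 := fun h0 => by
          obtain ⟨c, rfl⟩ := exists_quadPos_eq hm
          rw [hval, h0] at h13
          exact h13 rfl
        have hqr : q (r + 1) = q r ++ [quadProj (v ⟨r, hr⟩)] := by rw [hqs r hr, if_neg h0]
        rw [hqr]
        refine ⟨⟨?_, ?_, ?_, ?_, ?_, ?_, ?_, ?_⟩, ?_⟩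
        · simp [run, h12, hone, State.setNat, State.tick, hinp]
        · have ha : (run (ifEq flag one (incr count ;; copy base dst) skip) s₂).arr = s₂.arr := by
            simp [run, h12, hone, State.setNat, State.tick]
          rw [ha]
          refine h2.append hold fun c => ?_
          rw [← hval, ← h9.new _ (quadPos_lt c), h4]
        · simp [run, h12, hone, State.setNat, State.tick, hcount]
        · simp [run, h12, hone, State.setNat, State.tick, hdst]; ring
        · simp [run, h12, hone, State.setNat, State.tick, hdim]
        · simp [run, h12, hone, State.setNat, State.tick]
        · simp [run, h12, hone, State.setNat, State.tick, hthree]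
        · simp [run, h12, hone, State.setNat, State.tick, hsrc]
        · simp [run, h12, hone, State.setNat, State.tick]
          omega)
  rw [hsize] at hl
  rw [hrun, ← hq]
  obtain ⟨⟨-, h2, h3, -, h5, h6, -, -⟩, ht⟩ := hl
  exact ⟨h2, h3, h5, h6, by omega⟩

end Program
end NormalSurface

/-! ### The domination test and the output of a projective image. -/

namespace NormalSurface

namespace Program

open Cmd NReg RReg Arr

/-- The body of the loop of `testDominates`. -/
def testEntry : Cmd NReg RReg Arr :=
  load x proj atI ;; load y proj atJ ;; ifZero x (ifZero y skip (const dom 0)) skip ;;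
    incr atI ;; incr atJ

theorem run_testDominates {s : PState} {d : ℕ} (hd : s.nat dim3 = d) :
    (run testDominates s).arr = s.arr ∧
      ((run testDominates s).nat dom = 1 ∧ (∀ m < d, s.arr proj (s.nat baseI + m) = 0 →
          s.arr proj (s.nat baseJ + m) = 0) ∨
        (run testDominates s).nat dom = 0 ∧ ¬ ∀ m < d, s.arr proj (s.nat baseI + m) = 0 →
          s.arr proj (s.nat baseJ + m) = 0) ∧
      (∀ z, z ≠ .dom → z ≠ .atI → z ≠ .atJ → (run testDominates s).nat z = s.nat z) ∧
      (run testDominates s).time ≤ s.time + 4 + d * 8 := by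
  set s₁ : PState := run (const dom 1 ;; copy atI baseI ;; copy atJ baseJ) s with hs₁
  have hrun : run testDominates s = run (loop dim3 testEntry) s₁ := rfl
  have hdim : s₁.nat dim3 = d := by simp [hs₁, run, State.setNat, State.tick, hd]
  have htime : s₁.time = s.time + 3 := by simp [hs₁, run, State.setNat, State.tick]
  have hl := run_loop (c := testEntry) (x := dim3) (s := s₁)
    (fun r s' => s'.arr = s.arr ∧ s'.nat atI = s.nat baseI + r ∧ s'.nat atJ = s.nat baseJ + r ∧
      (s'.nat dom = 1 ∧ (∀ m < r, s.arr proj (s.nat baseI + m) = 0 →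
          s.arr proj (s.nat baseJ + m) = 0) ∨
        s'.nat dom = 0 ∧ ¬ ∀ m < r, s.arr proj (s.nat baseI + m) = 0 →
          s.arr proj (s.nat baseJ + m) = 0) ∧
      (∀ z, z ≠ .dom → z ≠ .atI → z ≠ .atJ → s'.nat z = s.nat z)) 8
    (by
      refine ⟨?_, ?_, ?_, Or.inl ⟨?_, by simp⟩, fun z h1 h2 h3 => ?_⟩
      all_goals simp [hs₁, run, State.setNat, State.tick]
      simp [h1, h2, h3])
    (by
      rintro r hr s' ⟨h1, h2, h3, h4, h5⟩
      -- An entry that passes leaves the verdict on the prefix unchanged; a failing one sets `dom`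
      -- to 0, and nothing in the loop sets it back.
      have hiff (h : s.arr proj (s.nat baseI + r) = 0 → s.arr proj (s.nat baseJ + r) = 0) :
          (∀ m < r + 1, s.arr proj (s.nat baseI + m) = 0 → s.arr proj (s.nat baseJ + m) = 0) ↔
            ∀ m < r, s.arr proj (s.nat baseI + m) = 0 → s.arr proj (s.nat baseJ + m) = 0 := by
        rw [Nat.forall_lt_succ_right]
        exact and_iff_left h
      by_cases hx : s.arr proj (s.nat baseI + r) = 0
      · by_cases hy : s.arr proj (s.nat baseJ + r) = 0
        · refine ⟨⟨?_, ?_, ?_, ?_, fun z z1 z2 z3 => ?_⟩, ?_⟩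
          · simp [testEntry, run, State.setNat, State.setReal, State.tick, h1, h2, h3, hx, hy]
          · simp [testEntry, run, State.setNat, State.setReal, State.tick, h1, h2, h3, hx, hy,
              add_assoc]
          · simp [testEntry, run, State.setNat, State.setReal, State.tick, h1, h2, h3, hx, hy,
              add_assoc]
          · rw [hiff fun _ => hy]
            simpa [testEntry, run, State.setNat, State.setReal, State.tick, h1, h2, h3, hx, hy]
              using h4
          · have := h5 z z1 z2 z3
            simp [testEntry, run, State.setNat, State.setReal, State.tick, h1, h2, h3, hx, hy, z2,
              z3, this]
          · simp [testEntry, run, State.setNat, State.setReal, State.tick, h1, h2, h3, hx, hy]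
        · refine ⟨⟨?_, ?_, ?_, Or.inr ⟨?_, ?_⟩, fun z z1 z2 z3 => ?_⟩, ?_⟩
          · simp [testEntry, run, State.setNat, State.setReal, State.tick, h1, h2, h3, hx, hy]
          · simp [testEntry, run, State.setNat, State.setReal, State.tick, h1, h2, h3, hx, hy,
              add_assoc]
          · simp [testEntry, run, State.setNat, State.setReal, State.tick, h1, h2, h3, hx, hy,
              add_assoc]
          · simp [testEntry, run, State.setNat, State.setReal, State.tick, h1, h2, h3, hx, hy]
          · exact fun h => hy (h r (by omega) hx)
          · have := h5 z z1 z2 z3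
            simp [testEntry, run, State.setNat, State.setReal, State.tick, h1, h2, h3, hx, hy, z1, z2,
              z3, this]
          · simp [testEntry, run, State.setNat, State.setReal, State.tick, h1, h2, h3, hx, hy]
      · refine ⟨⟨?_, ?_, ?_, ?_, fun z z1 z2 z3 => ?_⟩, ?_⟩
        · simp [testEntry, run, State.setNat, State.setReal, State.tick, h1, h2, h3, hx]
        · simp [testEntry, run, State.setNat, State.setReal, State.tick, h1, h2, h3, hx, add_assoc]
        · simp [testEntry, run, State.setNat, State.setReal, State.tick, h1, h2, h3, hx, add_assoc]
        · rw [hiff fun h => absurd h hx]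
          simpa [testEntry, run, State.setNat, State.setReal, State.tick, h1, h2, h3, hx]
            using h4
        · have := h5 z z1 z2 z3
          simp [testEntry, run, State.setNat, State.setReal, State.tick, h1, h2, h3, hx, z2,
            z3, this]
        · simp [testEntry, run, State.setNat, State.setReal, State.tick, h1, h2, h3, hx])
  rw [hdim] at hl
  rw [hrun]
  obtain ⟨⟨h1, -, -, h4, h5⟩, ht⟩ := hl
  exact ⟨h1, h4, h5, by omega⟩

theorem run_emit {s : PState} {d : ℕ} (hd : s.nat dim3 = d) :
    (run emit s).arr proj = s.arr proj ∧
      (∀ m < s.nat out, (run emit s).arr output m = s.arr output m) ∧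
      (∀ m < d, (run emit s).arr output (s.nat out + m) =
        s.arr proj (s.nat baseI + m) / ∑ e ∈ Finset.range d, s.arr proj (s.nat baseI + e)) ∧
      (run emit s).nat out = s.nat out + d ∧ (run emit s).nat len = s.nat len + 1 ∧
      (∀ z, z ≠ .out → z ≠ .len → z ≠ .atI → (run emit s).nat z = s.nat z) ∧
      (run emit s).time ≤ s.time + 6 + d * 10 := by
  set s₁ : PState := run (rzero sum ;; copy atI baseI) s with hs₁
  set s₂ : PState := run (loop dim3 (load x proj atI ;; rplus sum sum x ;; incr atI)) s₁ with hs₂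
  set s₃ : PState := run (copy atI baseI) s₂ with hs₃
  set s₄ : PState := run (loop dim3
    (load x proj atI ;; rdiv x x sum ;; store output out x ;; incr atI ;; incr out)) s₃ with hs₄
  have hrun : run emit s = run (incr len) s₄ := rfl
  have ht₁ : s₁.time = s.time + 2 := by
    simp [hs₁, run, State.setNat, State.setReal, State.tick]
  have hd₁ : s₁.nat dim3 = d := by
    simp [hs₁, run, State.setNat, State.setReal, State.tick, hd]
  have hl₁ := run_loop (c := load x proj atI ;; rplus sum sum x ;; incr atI) (x := dim3) (s := s₁)
    (fun r s' => s'.arr = s.arr ∧ s'.nat atI = s.nat baseI + r ∧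
      s'.real sum = ∑ e ∈ Finset.range r, s.arr proj (s.nat baseI + e) ∧
      (∀ z, z ≠ .atI → s'.nat z = s.nat z)) 4
    (by
      refine ⟨?_, ?_, ?_, fun z h1 => ?_⟩
      all_goals simp [hs₁, run, State.setNat, State.setReal, State.tick]
      simp [h1])
    (by
      rintro r hr s' ⟨h1, h2, h3, h4⟩
      refine ⟨⟨?_, ?_, ?_, fun z z1 => ?_⟩, ?_⟩
      · simp [run, State.setNat, State.setReal, State.tick, h1]
      · simp [run, State.setNat, State.setReal, State.tick, h2, add_assoc]
      · simp [run, State.setNat, State.setReal, State.tick, h1, h2, h3, Finset.sum_range_succ]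
      · simp [run, State.setNat, State.setReal, State.tick, z1, h4 z z1]
      · simp [run, State.setNat, State.setReal, State.tick])
  rw [hd₁, ← hs₂] at hl₁
  obtain ⟨⟨a1, -, a3, a4⟩, ht₂⟩ := hl₁
  set S := ∑ e ∈ Finset.range d, s.arr proj (s.nat baseI + e) with hS
  have hd₃ : s₃.nat dim3 = d := by
    simp [hs₃, run, State.setNat, State.tick, a4, hd]
  have ht₃ : s₃.time = s₂.time + 1 := by simp [hs₃, run, State.setNat, State.tick]
  have hl₂ := run_loop
    (c := load x proj atI ;; rdiv x x sum ;; store output out x ;; incr atI ;; incr out)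
    (x := dim3) (s := s₃)
    (fun r s' => s'.arr proj = s.arr proj ∧ s'.nat atI = s.nat baseI + r ∧
      s'.nat out = s.nat out + r ∧ s'.real sum = S ∧
      (∀ m < s.nat out, s'.arr output m = s.arr output m) ∧
      (∀ m < r, s'.arr output (s.nat out + m) = s.arr proj (s.nat baseI + m) / S) ∧
      (∀ z, z ≠ .out → z ≠ .atI → s'.nat z = s.nat z)) 6
    (by
      refine ⟨?_, ?_, ?_, ?_, ?_, ?_, fun z h1 h2 => ?_⟩
      all_goals simp [hs₃, run, State.setNat, State.tick, a1, a3, a4]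
      simp [h2, a4])
    (by
      rintro r hr s' ⟨h1, h2, h3, h4, h5, h6, h7⟩
      refine ⟨⟨?_, ?_, ?_, ?_, fun m hm => ?_, fun m hm => ?_, fun z z1 z2 => ?_⟩, ?_⟩
      · simp [run, State.setNat, State.setReal, State.setArr, State.tick, h1]
      · simp [run, State.setNat, State.setReal, State.setArr, State.tick, h2, add_assoc]
      · simp [run, State.setNat, State.setReal, State.setArr, State.tick, h3, add_assoc]
      · simp [run, State.setNat, State.setReal, State.setArr, State.tick, h4]
      · simp [run, State.setNat, State.setReal, State.setArr, State.tick, h3,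
          show m ≠ s.nat out + r by omega, h5 m hm]
      · simp only [run, State.setNat, State.setReal, State.setArr, State.tick, h1, h2, h3]
        rcases eq_or_ne m r with rfl | hmr
        · simp [h4]
        · simp [hmr, h6 m (by omega)]
      · simp [run, State.setNat, State.setReal, State.setArr, State.tick, z1, z2, h7 z z1 z2]
      · simp [run, State.setNat, State.setReal, State.setArr, State.tick])
  rw [hd₃, ← hs₄] at hl₂
  obtain ⟨⟨b1, -, b3, -, b5, b6, b7⟩, ht₄⟩ := hl₂
  have hin : run (incr len) s₄ = s₄.setNat len (s₄.nat len + 1) := rfl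
  rw [hrun, hin]
  refine ⟨b1, b5, b6, ?_, ?_, fun z z1 z2 z3 => ?_, ?_⟩
  · simp [State.setNat, b3]
  · simp [State.setNat, b7]
  · simp [State.setNat, z2, b7 z z1 z3]
  · simp only [State.setNat, State.tick]
    omega

end Program
end NormalSurface

/-! ### The selection phase and the total step count. -/

namespace NormalSurface

theorem sum_range_quadPos {n : ℕ} (f : ℕ → ℝ) :
    ∑ m ∈ Finset.range (3 * n), f m = ∑ c : QuadCoord n, f (quadPos c) := by
  rw [mul_comm, Finset.sum_range, ← Equiv.sum_comp finProdFinEquiv]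
  refine Finset.sum_congr rfl fun c _ => ?_
  congr 1
  simp [finProdFinEquiv, quadPos, add_comm]

namespace Program

open Cmd NReg RReg Arr

theorem HoldsList.dominates_iff {n : ℕ} {a : ℕ → ℝ} {q : List (QuadVec n)} (h : HoldsList a q)
    {i j : ℕ} (hi : i < q.length) (hj : j < q.length) :
    Dominates q[i] q[j] ↔ ∀ m < 3 * n, a (3 * n * i + m) = 0 → a (3 * n * j + m) = 0 := by
  constructor
  · intro hd m hm h0
    obtain ⟨c, rfl⟩ := exists_quadPos_eq hm
    rw [h i hi c] at h0
    rw [h j hj c, hd c h0]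
  · intro hd c h0
    rw [← h j hj c]
    refine hd _ (quadPos_lt c) ?_
    rw [h i hi c, h0]

/-- The body of the inner loop of `select`. -/
def compareStep : Cmd NReg RReg Arr :=
  ifEq i j skip (testDominates ;; ifEq dom one (const keep 0) skip) ;;
    incr j ;; plus baseJ baseJ dim3

/-- The comparison of one vector with all the others. -/
def compareAll : Cmd NReg RReg Arr :=
  const keep 1 ;; const j 0 ;; const baseJ 0 ;; loop count compareStep

theorem run_compareStep {n : ℕ} {q : List (QuadVec n)} {s : PState} {a b : ℕ}
    (ha : a < q.length) (hb : b < q.length) (hq : HoldsList (s.arr proj) q)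
    (hd : s.nat dim3 = 3 * n) (hi : s.nat i = a) (hI : s.nat baseI = 3 * n * a)
    (hj : s.nat j = b) (hJ : s.nat baseJ = 3 * n * b) (hone : s.nat one = 1) :
    (run compareStep s).arr = s.arr ∧ (run compareStep s).nat j = b + 1 ∧
      (run compareStep s).nat baseJ = 3 * n * (b + 1) ∧
      ((b ≠ a ∧ Dominates q[a] q[b]) ∧ (run compareStep s).nat keep = 0 ∨
        ¬ (b ≠ a ∧ Dominates q[a] q[b]) ∧ (run compareStep s).nat keep = s.nat keep) ∧
      (∀ z, z ≠ .dom → z ≠ .atI → z ≠ .atJ → z ≠ .keep → z ≠ .j → z ≠ .baseJ →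
        (run compareStep s).nat z = s.nat z) ∧
      (run compareStep s).time ≤ s.time + 9 + 24 * n := by
  by_cases hab : b = a
  · subst hab
    refine ⟨?_, ?_, ?_, Or.inr ⟨by simp, ?_⟩, fun z _ _ _ _ z5 z6 => ?_, ?_⟩
    · simp [compareStep, run, State.setNat, State.tick, hi, hj]
    · simp [compareStep, run, State.setNat, State.tick, hi, hj]
    · simp [compareStep, run, State.setNat, State.tick, hi, hj, hJ, hd]; ring
    · simp [compareStep, run, State.setNat, State.tick, hi, hj]
    · simp [compareStep, run, State.setNat, State.tick, hi, hj, z5, z6]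
    · simp [compareStep, run, State.setNat, State.tick, hi, hj]; omega
  · obtain ⟨t1, t2, t3, t4⟩ := run_testDominates (s := s.tick) hd
    change _ ≤ s.time + 1 + 4 + 3 * n * 8 at t4
    simp only [show s.tick.arr = s.arr from rfl, show s.tick.nat = s.nat from rfl, hI, hJ,
      ← hq.dominates_iff ha hb] at t1 t2 t3
    set s₁ := run testDominates s.tick with hs₁
    have hst : run compareStep s = run (ifEq dom one (const keep 0) skip ;;
        incr j ;; plus baseJ baseJ dim3) s₁ := by
      simp only [compareStep, run, hi, hj, if_neg (Ne.symm hab), hs₁]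
    have hone₁ : s₁.nat one = 1 := by rw [t3 _ (by decide) (by decide) (by decide), hone]
    have hj₁ : s₁.nat j = b := by rw [t3 _ (by decide) (by decide) (by decide), hj]
    have hJ₁ : s₁.nat baseJ = 3 * n * b := by rw [t3 _ (by decide) (by decide) (by decide), hJ]
    have hd₁ : s₁.nat dim3 = 3 * n := by rw [t3 _ (by decide) (by decide) (by decide), hd]
    have hk₁ : s₁.nat keep = s.nat keep := t3 _ (by decide) (by decide) (by decide)
    rw [hst]
    rcases t2 with ⟨h1, h2⟩ | ⟨h1, h2⟩
    · refine ⟨?_, ?_, ?_, Or.inl ⟨⟨hab, h2⟩, ?_⟩, fun z z1 z2 z3 z4 z5 z6 => ?_, ?_⟩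
      · simp [run, State.setNat, State.tick, hone₁, h1, t1]
      · simp [run, State.setNat, State.tick, hone₁, h1, hj₁]
      · simp [run, State.setNat, State.tick, hone₁, h1, hJ₁, hd₁]; ring
      · simp [run, State.setNat, State.tick, hone₁, h1]
      · simp [run, State.setNat, State.tick, hone₁, h1, z4, z5, z6, t3 z z1 z2 z3]
      · simp [run, State.setNat, State.tick, hone₁, h1]; omega
    · refine ⟨?_, ?_, ?_, Or.inr ⟨fun h => h2 h.2, ?_⟩, fun z z1 z2 z3 z4 z5 z6 => ?_, ?_⟩
      · simp [run, State.setNat, State.tick, hone₁, h1, t1]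
      · simp [run, State.setNat, State.tick, hone₁, h1, hj₁]
      · simp [run, State.setNat, State.tick, hone₁, h1, hJ₁, hd₁]; ring
      · simp [run, State.setNat, State.tick, hone₁, h1, hk₁]
      · simp [run, State.setNat, State.tick, hone₁, h1, z5, z6, t3 z z1 z2 z3]
      · simp [run, State.setNat, State.tick, hone₁, h1]; omega

theorem run_compareAll {n : ℕ} {q : List (QuadVec n)} {s : PState} {a : ℕ}
    (ha : a < q.length) (hq : HoldsList (s.arr proj) q) (hc : s.nat count = q.length)
    (hd : s.nat dim3 = 3 * n) (hi : s.nat i = a) (hI : s.nat baseI = 3 * n * a)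
    (hone : s.nat one = 1) :
    (run compareAll s).arr = s.arr ∧
      ((∃ b, ∃ hb : b < q.length, b ≠ a ∧ Dominates q[a] q[b]) ∧ (run compareAll s).nat keep = 0 ∨
        (∀ b (hb : b < q.length), b ≠ a → ¬ Dominates q[a] q[b]) ∧
          (run compareAll s).nat keep = 1) ∧
      (∀ z, z ≠ .dom → z ≠ .atI → z ≠ .atJ → z ≠ .keep → z ≠ .j → z ≠ .baseJ →
        (run compareAll s).nat z = s.nat z) ∧
      (run compareAll s).time ≤ s.time + 4 + q.length * (10 + 24 * n) := by
  set s₁ : PState := run (const keep 1 ;; const j 0 ;; const baseJ 0) s with hs₁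
  have hrun : run compareAll s = run (loop count compareStep) s₁ := rfl
  have hcount : s₁.nat count = q.length := by simp [hs₁, run, State.setNat, State.tick, hc]
  have htime : s₁.time = s.time + 3 := by simp [hs₁, run, State.setNat, State.tick]
  have hl := run_loop (c := compareStep) (x := count) (s := s₁)
    (fun r s' => s'.arr = s.arr ∧ s'.nat j = r ∧ s'.nat baseJ = 3 * n * r ∧
      ((∃ b, ∃ hb : b < q.length, b ≠ a ∧ Dominates q[a] q[b]) ∧ s'.nat keep = 0 ∨
        (∀ b (hb : b < q.length), b < r → b ≠ a → ¬ Dominates q[a] q[b]) ∧ s'.nat keep = 1) ∧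
      (∀ z, z ≠ .dom → z ≠ .atI → z ≠ .atJ → z ≠ .keep → z ≠ .j → z ≠ .baseJ →
        s'.nat z = s.nat z)) (10 + 24 * n)
    (by
      refine ⟨?_, ?_, ?_, Or.inr ⟨by simp, ?_⟩, fun z _ _ _ z4 z5 z6 => ?_⟩
      all_goals simp [hs₁, run, State.setNat, State.tick]
      simp [z4, z5, z6])
    (by
      rintro r hr s' ⟨h1, h2, h3, h4, h5⟩
      rw [hcount] at hr
      have hf : ∀ z, z ≠ .dom → z ≠ .atI → z ≠ .atJ → z ≠ .keep → z ≠ .j → z ≠ .baseJ →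
        s'.tick.nat z = s.nat z := h5
      obtain ⟨g1, g2, g3, g4, g5, g6⟩ := run_compareStep (s := s'.tick) (b := r) ha hr
        (by rw [show s'.tick.arr = s'.arr from rfl, h1]; exact hq)
        (by rw [hf, hd] <;> decide) (by rw [hf, hi] <;> decide) (by rw [hf, hI] <;> decide)
        h2 h3 (by rw [hf, hone] <;> decide)
      change _ = s'.arr at g1
      change _ ≤ s'.time + 1 + 9 + 24 * n at g6
      refine ⟨⟨g1.trans h1, g2, g3, ?_, fun z z1 z2 z3 z4 z5 z6 => ?_⟩, by omega⟩
      · rcases g4 with ⟨g, g'⟩ | ⟨g, g'⟩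
        · exact Or.inl ⟨⟨r, hr, g⟩, g'⟩
        · rw [g', show s'.tick.nat keep = s'.nat keep from rfl]
          refine h4.imp id fun h => ⟨fun b hb hbr hba hdom => ?_, h.2⟩
          rcases Nat.lt_succ_iff_lt_or_eq.1 hbr with hbr | rfl
          · exact h.1 b hb hbr hba hdom
          · exact g ⟨hba, hdom⟩
      · rw [g5 z z1 z2 z3 z4 z5 z6, hf z z1 z2 z3 z4 z5 z6])
  rw [hcount] at hl
  rw [hrun]
  obtain ⟨⟨h1, -, -, h4, h5⟩, ht⟩ := hl
  exact ⟨h1, h4.imp id fun h => ⟨fun b hb => h.1 b hb hb, h.2⟩, h5, by omega⟩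

theorem run_select {n : ℕ} {q : List (QuadVec n)} {s : PState}
    (hq : HoldsList (s.arr proj) q) (hc : s.nat count = q.length) (hn : s.nat dim = n)
    (hone : s.nat one = 1) :
    HoldsList ((run select s).arr output) (selection q) ∧
      (run select s).nat len = (selection q).length ∧
      (run select s).time ≤ s.time + 7 + q.length * (15 + 30 * n + q.length * (10 + 24 * n)) := by
  classical
  let P : Fin q.length → Prop := fun i => ∀ j, j ≠ i → ¬ Dominates (q.get i) (q.get j)
  -- The output after the first `r` candidates, used as the loop invariant; each candidate is
  -- nevertheless compared with the whole list `q`.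
  let L : ℕ → List (QuadVec n) := fun r =>
    (((List.finRange q.length).take r).filter fun i => P i).map fun i => projImage (q.get i)
  have hL : L q.length = selection q := by
    simp only [L, selection]
    rw [List.take_of_length_le (by simp)]
  have hLs : ∀ r (hr : r < q.length), L (r + 1) =
      if P ⟨r, hr⟩ then L r ++ [projImage q[r]] else L r := by
    intro r hr
    simp only [L]
    rw [List.take_succ_eq_append_getElem (by simpa using hr)]
    by_cases h : P ⟨r, hr⟩ <;> simp [h]
  set s₁ : PState := run (plus dim3 dim dim ;; plus dim3 dim3 dim ;;
    const len 0 ;; const out 0 ;; const i 0 ;; const baseI 0) s with hs₁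
  have hrun : run select s = run (loop count (compareAll ;; ifEq keep one emit skip ;;
    incr i ;; plus baseI baseI dim3)) s₁ := rfl
  have hcount : s₁.nat count = q.length := by simp [hs₁, run, State.setNat, State.tick, hc]
  have htime : s₁.time = s.time + 6 := by simp [hs₁, run, State.setNat, State.tick]
  have hl := run_loop (c := compareAll ;; ifEq keep one emit skip ;;
      incr i ;; plus baseI baseI dim3) (x := count) (s := s₁)
    (fun r s' => s'.arr proj = s.arr proj ∧ HoldsList (s'.arr output) (L r) ∧
      s'.nat len = (L r).length ∧ s'.nat out = 3 * n * (L r).length ∧ s'.nat i = r ∧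
      s'.nat baseI = 3 * n * r ∧ s'.nat count = q.length ∧ s'.nat dim3 = 3 * n ∧ s'.nat one = 1)
    (15 + 30 * n + q.length * (10 + 24 * n))
    (by
      refine ⟨?_, by simp [L, HoldsList], ?_⟩
      · simp [hs₁, run, State.setNat, State.tick]
      · simp [hs₁, run, State.setNat, State.tick, L, hc, hn, hone]
        ring)
    (by
      rintro r hr s' ⟨h1, h2, h3, h4, h5, h6, h7, h8, h9⟩
      rw [hcount] at hr
      obtain ⟨g1, g2, g3, g4⟩ := run_compareAll (s := s'.tick) hr
        (by rw [show s'.tick.arr = s'.arr from rfl, h1]; exact hq) h7 h8 h5 h6 h9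
      change _ = s'.arr at g1
      change ∀ z, _ → _ → _ → _ → _ → _ → _ = s'.nat z at g3
      change _ ≤ s'.time + 1 + 4 + _ at g4
      have hst : run (compareAll ;; ifEq keep one emit skip ;; incr i ;; plus baseI baseI dim3)
        s'.tick = run (ifEq keep one emit skip ;; incr i ;; plus baseI baseI dim3)
          (run compareAll s'.tick) := rfl
      rw [hst]
      set s₂ := run compareAll s'.tick with hs₂
      have k1 : s₂.nat one = 1 := by rw [g3, h9] <;> decide
      have k2 : s₂.nat i = r := by rw [g3, h5] <;> decide
      have k3 : s₂.nat baseI = 3 * n * r := by rw [g3, h6] <;> decide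
      have k4 : s₂.nat count = q.length := by rw [g3, h7] <;> decide
      have k5 : s₂.nat dim3 = 3 * n := by rw [g3, h8] <;> decide
      have k6 : s₂.nat len = (L r).length := by rw [g3, h3] <;> decide
      have k7 : s₂.nat out = 3 * n * (L r).length := by rw [g3, h4] <;> decide
      rcases g2 with ⟨⟨b, hb, hbr, hdom⟩, hk⟩ | ⟨hall, hk⟩
      · have hP : ¬ P ⟨r, hr⟩ := fun h => h ⟨b, hb⟩ (by simpa using hbr) hdom
        rw [hLs r hr, if_neg hP]
        refine ⟨⟨?_, ?_, ?_, ?_, ?_, ?_, ?_, ?_, ?_⟩, ?_⟩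
        · simp [run, State.setNat, State.tick, hk, k1, g1, h1]
        · simpa [run, State.setNat, State.tick, hk, k1, g1] using h2
        · simp [run, State.setNat, State.tick, hk, k1, k6]
        · simp [run, State.setNat, State.tick, hk, k1, k7]
        · simp [run, State.setNat, State.tick, hk, k1, k2]
        · simp [run, State.setNat, State.tick, hk, k1, k3, k5]; ring
        · simp [run, State.setNat, State.tick, hk, k1, k4]
        · simp [run, State.setNat, State.tick, hk, k1, k5]
        · simp [run, State.setNat, State.tick, hk, k1]
        · simp [run, State.setNat, State.tick, hk, k1]; omega
      · have hP : P ⟨r, hr⟩ := fun j hj => hall j j.2 fun h => hj (Fin.ext h)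
        obtain ⟨e1, e2, e3, e4, e5, e6, e7⟩ := run_emit (s := s₂.tick) k5
        change _ = s₂.arr proj at e1
        change ∀ m < s₂.nat out, _ = s₂.arr output m at e2
        change ∀ m < 3 * n, (run emit s₂.tick).arr output (s₂.nat out + m) =
          s₂.arr proj (s₂.nat baseI + m) /
            ∑ e ∈ Finset.range (3 * n), s₂.arr proj (s₂.nat baseI + e) at e3
        change _ = s₂.nat out + 3 * n at e4
        change _ = s₂.nat len + 1 at e5
        change ∀ z, _ → _ → _ → _ = s₂.nat z at e6
        change _ ≤ s₂.time + 1 + 6 + 3 * n * 10 at e7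
        have hst₂ : run (ifEq keep one emit skip ;; incr i ;; plus baseI baseI dim3) s₂ =
            run (incr i ;; plus baseI baseI dim3) (run emit s₂.tick) := by
          simp only [run, hk, k1, if_true]
        rw [hst₂, hLs r hr, if_pos hP]
        set s₃ := run emit s₂.tick with hs₃
        refine ⟨⟨?_, ?_, ?_, ?_, ?_, ?_, ?_, ?_, ?_⟩, ?_⟩
        · simp [run, State.setNat, State.tick, e1, g1, h1]
        · simp only [run, State.setNat, State.tick]
          refine h2.append (fun m hm => ?_) fun c => ?_
          · rw [e2 m (by rwa [k7]), g1]
          · rw [← k7, e3 _ (quadPos_lt c), g1, h1, k3, sum_range_quadPos]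
            simp only [hq r hr]
            rfl
        · simp [run, State.setNat, State.tick, e5, k6]
        · simp [run, State.setNat, State.tick, e4, k7]; ring
        · simp [run, State.setNat, State.tick, e6, k2]
        · simp [run, State.setNat, State.tick, e6, k3, k5]; ring
        · simp [run, State.setNat, State.tick, e6, k4]
        · simp [run, State.setNat, State.tick, e6, k5]
        · simp [run, State.setNat, State.tick, e6, k1]
        · simp [run, State.setNat, State.tick]; omega)
  rw [hcount] at hl
  rw [hrun, ← hL]
  obtain ⟨⟨-, h2, h3, -⟩, ht⟩ := hl
  exact ⟨h2, h3, by omega⟩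

/-- The program computes the conversion, and makes `O(n k ^ 2)` steps. -/
theorem run_stdToQuad {n k : ℕ} {v : Fin k → StdVec n} {s : PState} (hs : HoldsInput v s) :
    HoldsOutput (NormalSurface.stdToQuad v) (run stdToQuad s) ∧
      (0 < n → 0 < k → (run stdToQuad s).time ≤ s.time + 128 * (n * k ^ 2)) := by
  obtain ⟨h1, h2, h3, h4, h5⟩ := run_project hs
  obtain ⟨g1, g2, g3⟩ := run_select h1 h2 h3 h4
  refine ⟨⟨g2, fun r c => g1 r.1 r.2 c⟩, fun hn hk => ?_⟩
  change (run select (run project s)).time ≤ _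
  have hle : (projections v).length ≤ k := by
    classical
    refine (List.length_filter_le _ _).trans ?_
    simp
  set l := (projections v).length
  have e1 : l * (15 + 30 * n + l * (10 + 24 * n)) ≤ k * (15 + 30 * n + k * (10 + 24 * n)) := by
    gcongr
  -- The total is at most `13 + 22 k + 57 n k + 10 k ^ 2 + 24 n k ^ 2`. Each monomial is at most `n
  -- k ^ 2` and the coefficients add up to 126, whence 128.
  have f1 : k ≤ n * k ^ 2 := by nlinarith [Nat.mul_le_mul hn (Nat.mul_le_mul hk (le_refl k))]
  have f2 : n * k ≤ n * k ^ 2 := by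
    nlinarith [Nat.mul_le_mul (le_refl n) (Nat.mul_le_mul hk (le_refl k))]
  have f3 : k * k ≤ n * k ^ 2 := by nlinarith [Nat.mul_le_mul hn (le_refl (k * k))]
  nlinarith

end Program
end NormalSurface

theorem mainTheorem3 :
    ∃ C : ℕ, ∀ (n : ℕ) (T : NormalSurface.Triangulation n)
      (k : ℕ) (v : Fin k → NormalSurface.StdVec n),
      Function.Injective v →
      Set.range v = NormalSurface.stdSolutionSet T.toGluing →
        ((NormalSurface.stdToQuad v).Nodup ∧
          {w | w ∈ NormalSurface.stdToQuad v} = NormalSurface.quadSolutionSet T.toGluing) ∧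
        ∀ s : NormalSurface.State NormalSurface.NReg NormalSurface.RReg NormalSurface.Arr,
          NormalSurface.HoldsInput v s →
            NormalSurface.HoldsOutput (NormalSurface.stdToQuad v)
              (NormalSurface.run NormalSurface.Program.stdToQuad s) ∧
            (0 < n →
              (NormalSurface.run NormalSurface.Program.stdToQuad s).time ≤
                s.time + C * (n * k ^ 2)) := by
  refine ⟨128, fun n T k v hv hr => ⟨T.stdToQuad_correct hv hr, fun s hs => ?_⟩⟩
  obtain ⟨h1, h2⟩ := NormalSurface.Program.run_stdToQuad hs
  refine ⟨h1, fun hn => h2 hn ?_⟩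
  -- For `k = 0` the bound would be zero, while the initial assignments already take steps; this
  -- case cannot occur when `n > 0`.
  obtain ⟨x, hx⟩ := NormalSurface.stdSolutionSet_nonempty T.toGluing hn
  rw [← hr] at hx
  obtain ⟨j, -⟩ := hx
  exact j.pos
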